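/- **Setting.** Consider a grid with finite sets $N$ of buses, $G$ of generators, $E$ of lines $ij$ (pairs of buses) and times $t\in\mathcal T=\{1,\dots,H\}$, and the consensus problem $$\min_{x,y}\ C(x)\quad\text{s.t. } x_t\in \mathrm{AC}_t\ (t\in\mathcal T),\quad y_l\in\mathrm{Dev}_l\ (l\in E\cup G),\quad Ax+By=0,\qquad(\mathrm P)$$ where $x=(p^{G,\mathrm{AC}},\iota^{\mathrm{AC}},q^G,e,f,I^{\mathrm{re}},I^{\mathrm{im}})$, $y=(p^{G,\mathrm{Rmp}},\iota^{\mathrm{Tmp}},T)$, $A=(-\mathbb I\ \ 0)$ and $B=(\mathbb I\ \ 0)$ select the copies $(p^G,\iota)$, and $C(x)=\sum_{t,g}C_g(p^{G,\mathrm{AC}}_{g,t})$ with continuously differentiable $C_g$. Here: * $\mathrm{AC}_t$ is given by the rectangular AC power flow equations: with $\nu_i=e_i^2+f_i^2$, $C_{ij}=e_ie_j+f_if_j$, $S_{ij}=f_ie_j-e_if_j$ and $N_i$ the neighbours of $i$, real balance $\sum_{g\text{ at }i}p^G_g-P^D_i=(G_i+G_i^s)\nu_i+\sum_{j\in N_i}(C_{ij}G_{ij}+S_{ij}B_{ij})$,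 reactive balance $\sum_{g\text{ at }i}q^G_g-Q^D_i=-(B_i+B_i^s)\nu_i+\sum_{j\in N_i}(S_{ij}G_{ij}-C_{ij}B_{ij})$, voltage limits $(V_i^{\min})^2\le\nu_i\le (V_i^{\max})^2$, limits on the angle differences $\operatorname{atan2}(f_i,e_i)-\operatorname{atan2}(f_j,e_j)$ of the lines, box limits on $p^G_g$ and $q^G_g$, the line currents $I^{\mathrm{re}}_{ij}=G_{ij}(e_i-e_j)-B_{ij}(f_i-f_j)$, $I^{\mathrm{im}}_{ij}=G_{ij}(f_i-f_j)+B_{ij}(e_i-e_j)$, and $\iota_{ij}=(I^{\mathrm{re}}_{ij})^2+(I^{\mathrm{im}}_{ij})^2$ (all at time $t$). * For $l=g\in G$, $\mathrm{Dev}_g=\mathrm{Rmp}_g$ is given by the ramping limits $P_g^{Rmp,-}\le p_{g,t}-p_{g,t-1}\le P_g^{Rmp,+}$ $(t\ge2)$. * For $l\in E$, $\mathrm{Dev}_l=\mathrm{Tmp}_l=\{(\iota,T):\iota\ge0,\ T_t=\Phi_l^t(\iota)\le T^{\max}\ \forall t\}$. In the *transient* model, $\Phi_l^t(\iota)=T_t$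 with $T_0>0$ given and $T_t$ the value at time $\Delta>0$ of the solution of $\dot T=-K_4T^4-K_1T+K_0$ started at $T_{t-1}$; in the *steady-state* model, $\Phi_l^t(\iota)$ is the positive root of $K_4T^4+K_1T-K_0$. The coefficients (depending on $l$, and $K_1,K_0$ on $t$) are $K_4=\frac{\pi D_0\epsilon\sigma}{mc_p}$, $K_1=\frac{k^c}{mc_p}$, $K_0=\frac{\pi D_0\epsilon\sigma T_a^4+q^s-k^{c,0}+r\iota_t}{mc_p}$, with $m,c_p,r,D_0,\epsilon,\sigma,k^c>0$ and $\pi D_0\epsilon\sigma T_a^4+q^s-k^{c,0}>0$. One of the two models is fixed for all lines. Put $X=\prod_t\mathrm{AC}_t$, $Y=\prod_l\mathrm{Dev}_l$; $\mathcal N_X,\mathcal N_Y$ are the limiting (Mordukhovich) normal cones. **Stationarity.** A feasible $(x,y)\in X\times Y$ is an $\epsilon$-stationary point of (P) if for some $v$ $$\operatorname{dist}\big(0,\nabla C(x)+A^\top v+\mathcal N_X(x)\big)\le\epsilon,\quad \operatorname{dist}\big(0,B^\top v+\mathcal N_Y(y)\big)\le\epsilon,\quad \|Ax+By\|_2\le\epsilon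 .$$ (The distances being attained.) For given $w,\theta$, $(x,y,u)$ is an $\epsilon$-stationary point of the relaxed problem $\min C(x)+w^\top u+\frac\theta2\|u\|_2^2$ s.t. $x\in X$, $y\in Y$, $Ax+By+u=0$ if for some $v$ the first two inequalities hold and $\|w+\theta u+v\|_2\le\epsilon$, $\|Ax+By+u\|_2\le\epsilon$. **Algorithm.** Let $\mathcal L(x,y,u,v,w)=C(x)+w^\top u+\frac\theta2\|u\|^2+v^\top p+\frac\rho2\|p\|^2$ with $p=Ax+By+u$ and $\rho=2\theta$. One *inner iteration* maps $(x,y,u,v)$ to $(x^+,y^+,u^+,v^+)$ where * $x^+$ is a stationary point over $X$ of $\mathcal L(\cdot,y,u,v,w)$ (in the sense of $\mathcal N_X$) with $\mathcal L(x^+,y,u,v,w)\le\mathcal L(x,y,u,v,w)$; * $y^+\in Y$ is a stationary (KKT) point of $\mathcal L(x^+,\cdot,u,v,w)$ over $Y$: first-order optimality over each polyhedron $\mathrm{Rmp}_g$, and for each line the KKT system in $\iota$ with constraints $\iota\ge 0$ and $\Phi_l^t(\iota)\le T^{\max}$; the multipliers $\lambda_{l,t}\ge0$ of the latter satisfy $\sum_t\lambda_{l,t}<\Lambda$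 for all $l$ (the bound $\Lambda$ may depend on the iteration); * $u^+=\dfrac{-v-w-\rho(Ax^++By^+)}{\rho+\theta}$ and $v^+=v+\rho(Ax^++By^++u^+)$. Fix $\gamma>1$, $\theta^0>0$, $\omega,\kappa\in(0,1)$, a box $[\underline w,\overline w]$ and $w^0$. The *bi-level ADMM* with tolerance $\epsilon$ repeats inner iterations with fixed $(w,\theta)$ until $(x,y,u)$ is a $\kappa\epsilon$-stationary point of the relaxed problem. If then $\|Ax+By\|_2\le\epsilon$, it terminates. Otherwise it sets $\hat w=w+\theta u$, replaces $w$ by $\mathrm{Proj}_{[\underline w,\overline w]}(\hat w)$, replaces $\theta$ by $\gamma\theta$ if $\|u\|\ge\omega\|u_{\rm prev}\|$ (where $u_{\rm prev}$ is $u$ at the end of the previous inner loop, or the initial $u$) and keeps $\theta$ otherwise, and starts a new inner loop. Every inner loop starts at a point with $y\in Y$ and $w+\theta u=-v$. It is *warm-started* if $(x,y,u)$ is the final point of the previous loop. **Proposition (outer convergence rate).** In the transient model there is a finite constant $C_\Delta$ such that all $\Phi_l^t$ are differentiable with $C_\Delta$-Lipschitz gradient on the convex hull of $\{\iota\ge0:\Phi_l^s(\iota)\le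 T^{\max}\ \forall s\}$. Fix any such $C_\Delta$, and suppose that in the transient model $\rho\ge2C_\Delta\Lambda$ at every inner iteration (no such condition is needed in the steady-state model). Let $L\in\mathbb R$. 1. There is a constant $K$, depending only on the data of (P), $\gamma,\theta^0,\omega,\kappa,\underline w,\overline w,w^0,C_\Delta$ and $L$, such that for every $\epsilon\in(0,1]$, every execution of the bi-level ADMM in which each inner loop starts with $\mathcal L\le L$ terminates, at an $\epsilon$-stationary point of (P), after at most $K/\epsilon^4$ inner iterations in total. 2. For every $W$ there is a constant $K$, depending only on the same quantities and $W$, such that for every $\epsilon\in(0,1]$, every execution in which the unprojected outer dual sequence satisfies $\|\hat w\|\le W$ at the end of every inner loop, the first inner loop starts with $\mathcal L\le L$, and every later one is warm-started or starts with $\mathcal L\le L$, terminates, at an $\epsilon$-stationary point of (P), after at most $K/\epsilon^3$ inner iterations in total. -/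

import Mathlib

open scoped Topology NNReal RealInnerProductSpace

noncomputable section

namespace DLR

/-! ### Normal cones -/

/-- Regular (Fréchet) normals to `S` at `a`: `⟪v, z - a⟫ ≤ o(‖z - a‖)` for `z ∈ S`. -/
def regularNormalCone {V : Type*} [NormedAddCommGroup V] [InnerProductSpace ℝ V]
    (S : Set V) (a : V) : Set V :=
  {v | a ∈ S ∧ ∀ c : ℝ, 0 < c → ∀ᶠ z in 𝓝[S] a, ⟪v, z - a⟫ ≤ c * ‖z - a‖}

/-- The (general, limiting) normal cone of variational analysis: limits of regular normals at
points of `S` converging to `a`. -/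
def normalCone {V : Type*} [NormedAddCommGroup V] [InnerProductSpace ℝ V]
    (S : Set V) (a : V) : Set V :=
  {v | a ∈ S ∧ ∃ (z : ℕ → V) (n : ℕ → V), (∀ i, n i ∈ regularNormalCone S (z i)) ∧
    Filter.Tendsto z Filter.atTop (𝓝 a) ∧ Filter.Tendsto n Filter.atTop (𝓝 v)}

/-! ### The scalar heat equation -/

/-- `T` solves `dT/dτ = -K₄ T⁴ - K₁ T + K₀` on `[0, Δ]` with `T 0 = T₀`. -/
def IsHeatSolution (K4 K1 K0 Δ T0 : ℝ) (T : ℝ → ℝ) : Prop :=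
  T 0 = T0 ∧ ∀ τ ∈ Set.Icc (0 : ℝ) Δ,
    HasDerivWithinAt T (-K4 * T τ ^ 4 - K1 * T τ + K0) (Set.Icc 0 Δ) τ

open Classical in
/-- The temperature at the end of an interval of length `Δ`, from the temperature `T0` at its
beginning (`0` if the heat equation has no solution on the whole interval; this does not happen
for nonnegative `T0` and positive `K4`, `K1`, `K0`). -/
def heatFlow (K4 K1 K0 Δ T0 : ℝ) : ℝ :=
  if h : ∃ T : ℝ → ℝ, IsHeatSolution K4 K1 K0 Δ T0 T then h.choose Δ else 0

/-- The steady-state temperature: the positive root `s₁` of `K₄ T⁴ + K₁ T - K₀`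
(there is exactly one when the coefficients are positive). -/
def steadyTemp (K4 K1 K0 : ℝ) : ℝ :=
  sSup {s : ℝ | 0 < s ∧ K4 * s ^ 4 + K1 * s - K0 = 0}

/-- The two line-temperature models. -/
inductive TempModel
  | steady
  | transient

/-! ### Data of the multi-period AC optimal power flow with dynamic line rating -/

/-- Problem data: buses `N`, generators `G`, lines `E` (each line is a pair of buses), and `H`
dispatch intervals of length `Δ`. -/
structure Grid (N G E : Type*) (H : ℕ) where
  /-- the pair `ij` of buses that is the line -/
  ends : E ↪ N × N
  /-- the bus of a generator -/
  bus : G → N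
  /-- line conductances and susceptances `G_ij`, `B_ij` -/
  cond : N → N → ℝ
  susc : N → N → ℝ
  /-- diagonal terms `G_i`, `B_i` and shunt terms `G_i^s`, `B_i^s` -/
  condBus : N → ℝ
  suscBus : N → ℝ
  condShunt : N → ℝ
  suscShunt : N → ℝ
  /-- real and reactive demand -/
  PD : N → Fin H → ℝ
  QD : N → Fin H → ℝ
  Vmin : N → ℝ
  Vmax : N → ℝ
  angMin : E → ℝ
  angMax : E → ℝ
  Pmin : G → ℝ
  Pmax : G → ℝ
  Qmin : G → ℝ
  Qmax : G → ℝ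
  /-- ramping limits -/
  rampMin : G → ℝ
  rampMax : G → ℝ
  /-- generation costs -/
  genCost : G → ℝ → ℝ
  genCost_smooth : ∀ g, ContDiff ℝ 1 (genCost g)
  /-- length of a dispatch interval -/
  Δ : ℝ
  Δ_pos : 0 < Δ
  /-- mass per unit length, heat capacity, resistivity, diameter, emissivity of a line -/
  mass : E → ℝ
  mass_pos : ∀ l, 0 < mass l
  heatCap : E → ℝ
  heatCap_pos : ∀ l, 0 < heatCap l
  resist : E → ℝ
  resist_pos : ∀ l, 0 < resist l
  diam : E → ℝ
  diam_pos : ∀ l, 0 < diam l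
  emiss : E → ℝ
  emiss_pos : ∀ l, 0 < emiss l
  /-- Stefan-Boltzmann constant -/
  sigma : ℝ
  sigma_pos : 0 < sigma
  /-- ambient temperature and solar gain -/
  Ta : E → Fin H → ℝ
  qs : E → Fin H → ℝ
  /-- linearized convective cooling `q^c(T) = kc * T + kc0` -/
  kc : E → Fin H → ℝ
  kc_pos : ∀ l t, 0 < kc l t
  kc0 : E → Fin H → ℝ
  /-- the current-free part of the constant coefficient of the heat equation is positive -/
  source_pos : ∀ l t,
    0 < Real.pi * diam l * emiss l * sigma * Ta l t ^ 4 + qs l t - kc0 l t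
  /-- initial and maximal admissible line temperature -/
  Tinit : E → ℝ
  Tinit_pos : ∀ l, 0 < Tinit l
  Tmax : ℝ

/-! ### Vectors -/

/-- Space of the consensus constraints (and of `u`, `v`, `w`): real generation and squared
current, at every time. -/
abbrev CVec (G E : Type*) (H : ℕ) := EuclideanSpace ℝ ((G ⊕ E) × Fin H)

/-- `x = (p^{G,AC}, ι^{AC}, q^G, e, f, I^re, I^im)`. -/
abbrev XVec (N G E : Type*) (H : ℕ) :=
  EuclideanSpace ℝ (((G ⊕ E) × Fin H) ⊕ ((G ⊕ N ⊕ N ⊕ E ⊕ E) × Fin H))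

/-- `y = (p^{G,Rmp}, ι^{Tmp}, T^{Tmp})`. -/
abbrev YVec (G E : Type*) (H : ℕ) :=
  EuclideanSpace ℝ (((G ⊕ E) × Fin H) ⊕ (E × Fin H))

section coordinates

variable {N G E : Type*} {H : ℕ}

def XVec.pG (x : XVec N G E H) (g : G) (t : Fin H) : ℝ := x (.inl (.inl g, t))
def XVec.iota (x : XVec N G E H) (l : E) (t : Fin H) : ℝ := x (.inl (.inr l, t))
def XVec.qG (x : XVec N G E H) (g : G) (t : Fin H) : ℝ := x (.inr (.inl g, t))
def XVec.e (x : XVec N G E H) (i : N) (t : Fin H) : ℝ := x (.inr (.inr (.inl i), t))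
def XVec.f (x : XVec N G E H) (i : N) (t : Fin H) : ℝ := x (.inr (.inr (.inr (.inl i)), t))
def XVec.Ire (x : XVec N G E H) (l : E) (t : Fin H) : ℝ :=
  x (.inr (.inr (.inr (.inr (.inl l))), t))
def XVec.Iim (x : XVec N G E H) (l : E) (t : Fin H) : ℝ :=
  x (.inr (.inr (.inr (.inr (.inr l))), t))

def YVec.pG (y : YVec G E H) (g : G) : EuclideanSpace ℝ (Fin H) :=
  WithLp.toLp 2 fun t => y (.inl (.inl g, t))
def YVec.iota (y : YVec G E H) (l : E) : EuclideanSpace ℝ (Fin H) :=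
  WithLp.toLp 2 fun t => y (.inl (.inr l, t))
def YVec.temp (y : YVec G E H) (l : E) (t : Fin H) : ℝ := y (.inr (l, t))

end coordinates

namespace Grid

section sets

variable {N G E : Type*} {H : ℕ} (P : Grid N G E H)

/-! ### AC power flow constraints -/

/-- `N_i`, the neighbours of bus `i`. -/
def IsNeighbor (i j : N) : Prop :=
  (i, j) ∈ Set.range P.ends ∨ (j, i) ∈ Set.range P.ends

open Classical in
/-- The AC power flow constraint set of time `t`, for the slice of `x` at time `t`. -/
def AC [Fintype N] [Fintype G] (t : Fin H) : Set (XVec N G E H) :=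
  {x |
    let nu : N → ℝ := fun i => x.e i t ^ 2 + x.f i t ^ 2
    let c : N → N → ℝ := fun i j => x.e i t * x.e j t + x.f i t * x.f j t
    let s : N → N → ℝ := fun i j => x.f i t * x.e j t - x.e i t * x.f j t
    let phi : N → ℝ := fun i => Complex.arg ⟨x.e i t, x.f i t⟩
    (∀ i, ∑ g with P.bus g = i, x.pG g t - P.PD i t =
      (P.condBus i + P.condShunt i) * nu i +
        ∑ j with P.IsNeighbor i j, (c i j * P.cond i j + s i j * P.susc i j)) ∧
    (∀ i, ∑ g with P.bus g = i, x.qG g t - P.QD i t =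
      -(P.suscBus i + P.suscShunt i) * nu i +
        ∑ j with P.IsNeighbor i j, (s i j * P.cond i j - c i j * P.susc i j)) ∧
    (∀ i, P.Vmin i ^ 2 ≤ nu i ∧ nu i ≤ P.Vmax i ^ 2) ∧
    (∀ l, P.angMin l ≤ phi (P.ends l).1 - phi (P.ends l).2 ∧
      phi (P.ends l).1 - phi (P.ends l).2 ≤ P.angMax l) ∧
    (∀ g, P.Pmin g ≤ x.pG g t ∧ x.pG g t ≤ P.Pmax g) ∧
    (∀ g, P.Qmin g ≤ x.qG g t ∧ x.qG g t ≤ P.Qmax g) ∧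
    (∀ l, x.Ire l t =
      P.cond (P.ends l).1 (P.ends l).2 * (x.e (P.ends l).1 t - x.e (P.ends l).2 t) -
      P.susc (P.ends l).1 (P.ends l).2 * (x.f (P.ends l).1 t - x.f (P.ends l).2 t)) ∧
    (∀ l, x.Iim l t =
      P.cond (P.ends l).1 (P.ends l).2 * (x.f (P.ends l).1 t - x.f (P.ends l).2 t) +
      P.susc (P.ends l).1 (P.ends l).2 * (x.e (P.ends l).1 t - x.e (P.ends l).2 t)) ∧
    (∀ l, x.iota l t = x.Ire l t ^ 2 + x.Iim l t ^ 2)}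

/-- Feasible `x`: the AC constraints at all times. -/
def X [Fintype N] [Fintype G] : Set (XVec N G E H) := {x | ∀ t, x ∈ P.AC t}

/-! ### Line temperatures -/

/-- `K₄ = π D₀ ε σ / (m c_p)`. -/
def K4 (l : E) : ℝ :=
  Real.pi * P.diam l * P.emiss l * P.sigma / (P.mass l * P.heatCap l)

/-- `K₁ = k^c / (m c_p)`. -/
def K1 (l : E) (t : Fin H) : ℝ := P.kc l t / (P.mass l * P.heatCap l)

/-- `K₀ = (π D₀ ε σ T_a⁴ + q^s - k^{c,0} + r ι) / (m c_p)`. -/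
def K0 (l : E) (t : Fin H) (iota : ℝ) : ℝ :=
  (Real.pi * P.diam l * P.emiss l * P.sigma * P.Ta l t ^ 4 + P.qs l t - P.kc0 l t
    + P.resist l * iota) / (P.mass l * P.heatCap l)

/-- Transient temperatures at the ends of the intervals: value `0` is the initial temperature,
value `n + 1` the temperature at the end of the interval with index `n`. -/
def transientTemp (l : E) (iota : EuclideanSpace ℝ (Fin H)) : ℕ → ℝ
  | 0 => P.Tinit l
  | n + 1 =>
    if h : n < H then
      heatFlow (P.K4 l) (P.K1 l ⟨n, h⟩) (P.K0 l ⟨n, h⟩ (iota ⟨n, h⟩)) P.Δ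
        (transientTemp l iota n)
    else transientTemp l iota n

/-- The temperature at the end of interval `t` as a function of the squared currents on the
line: the multi-step solution `Φ^t` in the transient model, the steady-state temperature in the
steady-state model. -/
def tempMap (model : TempModel) (l : E) (t : Fin H) (iota : EuclideanSpace ℝ (Fin H)) : ℝ :=
  match model with
  | .steady => steadyTemp (P.K4 l) (P.K1 l t) (P.K0 l t (iota t))
  | .transient => P.transientTemp l iota (t + 1)

/-- The squared currents on line `l` that respect the temperature limit. -/
def admissibleCurrents (model : TempModel) (l : E) : Set (EuclideanSpace ℝ (Fin H)) :=
  {iota | (∀ t, 0 ≤ iota t) ∧ ∀ t, P.tempMap model l t iota ≤ P.Tmax}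

/-- The temperature model of line `l`. -/
def Tmp (model : TempModel) (l : E) : Set (YVec G E H) :=
  {y | y.iota l ∈ P.admissibleCurrents model l ∧
    ∀ t, y.temp l t = P.tempMap model l t (y.iota l)}

/-- The ramping constraints of generator `g`. -/
def Rmp (g : G) : Set (EuclideanSpace ℝ (Fin H)) :=
  {p | ∀ s t : Fin H, (s : ℕ) + 1 = t →
    P.rampMin g ≤ p t - p s ∧ p t - p s ≤ P.rampMax g}

/-- Feasible `y`: all device-level constraints. -/
def Y (model : TempModel) : Set (YVec G E H) :=
  {y | (∀ l, y ∈ P.Tmp model l) ∧ ∀ g, y.pG g ∈ P.Rmp g}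

/-- `C` is a smoothness constant of the transient maps `Φ^t`: they are differentiable with
`C`-Lipschitz gradient on the convex hull of the admissible currents of each line. -/
def IsSmoothnessConst (C : ℝ≥0) : Prop :=
  ∀ (l : E) (t : Fin H),
    (∀ iota ∈ convexHull ℝ (P.admissibleCurrents .transient l),
      DifferentiableAt ℝ (P.tempMap .transient l t) iota) ∧
    LipschitzOnWith C (gradient (P.tempMap .transient l t))
      (convexHull ℝ (P.admissibleCurrents .transient l))

end sets

/-! ### The consensus problem and its augmented Lagrangian relaxation -/

section problem

variable {N G E : Type*} [Fintype N] [Fintype G] [Fintype E] {H : ℕ}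

open Classical in
/-- The selection matrix `A = (-I 0)`. -/
def matA (N G E : Type*) (H : ℕ) : Matrix ((G ⊕ E) × Fin H)
    (((G ⊕ E) × Fin H) ⊕ ((G ⊕ N ⊕ N ⊕ E ⊕ E) × Fin H)) ℝ :=
  Matrix.fromCols (-1) 0

open Classical in
/-- The selection matrix `B = (I 0)`. -/
def matB (G E : Type*) (H : ℕ) : Matrix ((G ⊕ E) × Fin H)
    (((G ⊕ E) × Fin H) ⊕ (E × Fin H)) ℝ :=
  Matrix.fromCols 1 0

/-- Action of a matrix on Euclidean vectors. -/
def act {m n : Type*} [Fintype n] (M : Matrix m n ℝ) (z : EuclideanSpace ℝ n) :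
    EuclideanSpace ℝ m :=
  WithLp.toLp 2 (M.mulVec z.ofLp)

/-- The consensus residual `A x + B y`. -/
def gap (x : XVec N G E H) (y : YVec G E H) : CVec G E H :=
  act (matA N G E H) x + act (matB G E H) y

variable (P : Grid N G E H)

/-- Total generation cost `C(x)`. -/
def cost (x : XVec N G E H) : ℝ := ∑ t, ∑ g, P.genCost g (x.pG g t)

/-- `(x, y)` is an `ε`-stationary point of the consensus problem
`min C(x)` s.t. `x ∈ X`, `y ∈ Y`, `A x + B y = 0`. -/
def IsStationary (model : TempModel) (ε : ℝ) (x : XVec N G E H) (y : YVec G E H) : Prop :=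
  ∃ v : CVec G E H,
    (∃ n ∈ normalCone P.X x, ‖gradient P.cost x + act (matA N G E H).transpose v + n‖ ≤ ε) ∧
    (∃ n ∈ normalCone (P.Y model) y, ‖act (matB G E H).transpose v + n‖ ≤ ε) ∧
    ‖gap x y‖ ≤ ε

/-- `(x, y, u)` is an `ε`-stationary point of the relaxed problem
`min C(x) + wᵀu + θ/2 ‖u‖²` s.t. `x ∈ X`, `y ∈ Y`, `A x + B y + u = 0`. -/
def IsRelaxedStationary (model : TempModel) (w : CVec G E H) (θ ε : ℝ)
    (x : XVec N G E H) (y : YVec G E H) (u : CVec G E H) : Prop :=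
  ∃ v : CVec G E H,
    (∃ n ∈ normalCone P.X x, ‖gradient P.cost x + act (matA N G E H).transpose v + n‖ ≤ ε) ∧
    (∃ n ∈ normalCone (P.Y model) y, ‖act (matB G E H).transpose v + n‖ ≤ ε) ∧
    ‖w + θ • u + v‖ ≤ ε ∧
    ‖gap x y + u‖ ≤ ε

/-- The augmented Lagrangian `L(x, y, u, v, w)`. -/
def augLag (w : CVec G E H) (θ ρ : ℝ)
    (x : XVec N G E H) (y : YVec G E H) (u v : CVec G E H) : ℝ :=
  P.cost x + ⟪w, u⟫ + θ / 2 * ‖u‖ ^ 2 + ⟪v, gap x y + u⟫ + ρ / 2 * ‖gap x y + u‖ ^ 2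

/-- `x` is a stationary point of `L(·, y, u, v, w)` on the set `X` (both are separable over the
times, so this is stationarity of all the slices of `x`). -/
def IsXStationary (ρ : ℝ) (x : XVec N G E H) (y : YVec G E H) (u v : CVec G E H) : Prop :=
  ∃ n ∈ normalCone P.X x,
    gradient P.cost x + act (matA N G E H).transpose (v + ρ • (gap x y + u)) + n = 0

/-- `y` is a stationary (KKT) point of `L(x, ·, u, v, w)` on the device-level sets, where
`lam l t` are the multipliers of the temperature limits of line `l`. With
`d = v + ρ (A x + B y + u)`, the gradient of `L` in `y` is `Bᵀ d`.
For a line this is the KKT system in the squared currents (the temperatures being a function of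
them), `mu` belonging to the constraint that squared currents are nonnegative; for a generator it
is first-order optimality over the convex set of ramping constraints. -/
def IsYKKT (model : TempModel) (ρ : ℝ) (x : XVec N G E H) (y : YVec G E H)
    (u v : CVec G E H) (lam : E → Fin H → ℝ) : Prop :=
  let d : CVec G E H := v + ρ • (gap x y + u)
  y ∈ P.Y model ∧
  (∀ l, (∀ t, 0 ≤ lam l t ∧ lam l t * (P.tempMap model l t (y.iota l) - P.Tmax) = 0) ∧
    ∃ mu : Fin H → ℝ, (∀ t, 0 ≤ mu t ∧ mu t * y.iota l t = 0) ∧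
      ∀ s, d (.inr l, s) + ∑ t, lam l t * (gradient (P.tempMap model l t) (y.iota l)) s
        - mu s = 0) ∧
  (∀ g, ∀ z ∈ P.Rmp g, 0 ≤ ∑ t, d (.inl g, t) * (z t - y.pG g t))

end problem

end Grid

/-! ### The bi-level ADMM algorithm -/

/-- The iterate `(x, y, u, v)` of the inner ADMM. -/
structure Iterate (N G E : Type*) (H : ℕ) where
  x : XVec N G E H
  y : YVec G E H
  u : CVec G E H
  v : CVec G E H

/-- Parameters: factor `γ`, initial penalty `θ0`, slack reduction factor `ω`, projection box
`[wlo, whi]` and initial value `w0` of the outer dual; `κ ε` is the tolerance of the inner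
loop. -/
structure Params (G E : Type*) (H : ℕ) where
  γ : ℝ
  one_lt_γ : 1 < γ
  θ0 : ℝ
  θ0_pos : 0 < θ0
  ω : ℝ
  ω_pos : 0 < ω
  ω_lt_one : ω < 1
  κ : ℝ
  κ_pos : 0 < κ
  κ_lt_one : κ < 1
  wlo : CVec G E H
  whi : CVec G E H
  wlo_le_whi : ∀ i, wlo i ≤ whi i
  w0 : CVec G E H

/-- Record of an execution, indexed by the total number of inner iterations: iteration `n` turns
`pre n` into `post n` with the outer variables `w n`, `θ n`; `uLast n` is the slack at the end of
the previous outer iteration (the initial slack during the first one), and `Λ n` the bound on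
the multipliers. -/
structure Trace (N G E : Type*) (H : ℕ) where
  pre : ℕ → Iterate N G E H
  post : ℕ → Iterate N G E H
  w : ℕ → CVec G E H
  θ : ℕ → ℝ
  uLast : ℕ → CVec G E H
  Λ : ℕ → ℝ

section algorithm

variable {N G E : Type*} [Fintype N] [Fintype G] [Fintype E] {H : ℕ}

/-- Componentwise projection on the box `[lo, hi]`. -/
def projBox (lo hi w : CVec G E H) : CVec G E H :=
  WithLp.toLp 2 fun i => max (lo i) (min (hi i) (w i))

/-- One iteration of the inner three-block ADMM, with penalty `ρ = 2 θ`, from `a` to `b`. -/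
structure InnerStep (P : Grid N G E H) (model : TempModel) (w : CVec G E H) (θ Λ : ℝ)
    (a b : Iterate N G E H) : Prop where
  x_stationary : P.IsXStationary (2 * θ) b.x a.y a.u a.v
  x_descent : P.augLag w θ (2 * θ) b.x a.y a.u a.v ≤ P.augLag w θ (2 * θ) a.x a.y a.u a.v
  y_stationary : ∃ lam : E → Fin H → ℝ,
    P.IsYKKT model (2 * θ) b.x b.y a.u a.v lam ∧ ∀ l, ∑ t, lam l t < Λ
  u_update : b.u = (2 * θ + θ)⁻¹ • (-a.v - w - (2 * θ) • Grid.gap b.x b.y)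
  v_update : b.v = a.v + (2 * θ) • (Grid.gap b.x b.y + b.u)

/-- Admissible start of an inner loop. -/
def IsStart (P : Grid N G E H) (model : TempModel) (w : CVec G E H) (θ : ℝ)
    (a : Iterate N G E H) : Prop :=
  a.y ∈ P.Y model ∧ w + θ • a.u = -a.v

namespace Trace

variable (tr : Trace N G E H) (P : Grid N G E H) (model : TempModel) (par : Params G E H) (ε : ℝ)

/-- The inner loop ends with iteration `n`. -/
def InnerExit (n : ℕ) : Prop :=
  P.IsRelaxedStationary model (tr.w n) (tr.θ n) (par.κ * ε)
    (tr.post n).x (tr.post n).y (tr.post n).u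

/-- The algorithm terminates after iteration `n`. -/
def Terminates (n : ℕ) : Prop :=
  tr.InnerExit P model par ε n ∧ ‖Grid.gap (tr.post n).x (tr.post n).y‖ ≤ ε

/-- The algorithm has not terminated before iteration `n`. -/
def Running (n : ℕ) : Prop := ∀ m < n, ¬ tr.Terminates P model par ε m

/-- The unprojected outer dual update `w + θ u` computed from iteration `n`. -/
def wHat (n : ℕ) : CVec G E H := tr.w n + tr.θ n • (tr.post n).u

/-- The augmented Lagrangian at the beginning of iteration `n`. -/
def preLag (n : ℕ) : ℝ :=
  P.augLag (tr.w n) (tr.θ n) (2 * tr.θ n)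
    (tr.pre n).x (tr.pre n).y (tr.pre n).u (tr.pre n).v

open Classical in
/-- `tr` is an execution of the bi-level ADMM with tolerance `ε` (up to its termination). -/
structure IsRun : Prop where
  init_w : tr.w 0 = par.w0
  init_θ : tr.θ 0 = par.θ0
  init_uLast : tr.uLast 0 = (tr.pre 0).u
  init_start : IsStart P model (tr.w 0) (tr.θ 0) (tr.pre 0)
  step : ∀ n, tr.Running P model par ε n →
    InnerStep P model (tr.w n) (tr.θ n) (tr.Λ n) (tr.pre n) (tr.post n)
  continue_inner : ∀ n, tr.Running P model par ε (n + 1) → ¬ tr.InnerExit P model par ε n →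
    tr.pre (n + 1) = tr.post n ∧ tr.w (n + 1) = tr.w n ∧ tr.θ (n + 1) = tr.θ n ∧
      tr.uLast (n + 1) = tr.uLast n
  outer_update : ∀ n, tr.Running P model par ε (n + 1) → tr.InnerExit P model par ε n →
    tr.w (n + 1) = projBox par.wlo par.whi (tr.wHat n) ∧
    tr.θ (n + 1) =
      (if par.ω * ‖tr.uLast n‖ ≤ ‖(tr.post n).u‖ then par.γ * tr.θ n else tr.θ n) ∧
    tr.uLast (n + 1) = (tr.post n).u ∧
    IsStart P model (tr.w (n + 1)) (tr.θ (n + 1)) (tr.pre (n + 1))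

/-- The inner loop that begins with iteration `n + 1` starts from the final point `(x, y, u)` of
the preceding one. -/
def IsWarm (n : ℕ) : Prop :=
  (tr.pre (n + 1)).x = (tr.post n).x ∧ (tr.pre (n + 1)).y = (tr.post n).y ∧
    (tr.pre (n + 1)).u = (tr.post n).u

/-- Every inner loop starts with augmented Lagrangian value at most `L`. -/
def StartsBounded (L : ℝ) : Prop :=
  tr.preLag P 0 ≤ L ∧
  ∀ n, tr.Running P model par ε (n + 1) → tr.InnerExit P model par ε n →
    tr.preLag P (n + 1) ≤ L

/-- The first inner loop starts with augmented Lagrangian value at most `L`; the others do so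
or are warm-started. -/
def StartsBoundedOrWarm (L : ℝ) : Prop :=
  tr.preLag P 0 ≤ L ∧
  ∀ n, tr.Running P model par ε (n + 1) → tr.InnerExit P model par ε n →
    tr.preLag P (n + 1) ≤ L ∨ tr.IsWarm n

/-- The unprojected outer duals are bounded by `W`. -/
def DualsBounded (W : ℝ) : Prop :=
  ∀ n, tr.Running P model par ε n → tr.InnerExit P model par ε n → ‖tr.wHat n‖ ≤ W

/-- After at most `M` iterations the algorithm terminates, at an `ε`-stationary point of the
consensus problem. -/
def ReachesWithin (M : ℝ) : Prop :=
  ∃ n : ℕ, ((n : ℝ) + 1) ≤ M ∧ tr.Running P model par ε n ∧ tr.Terminates P model par ε n ∧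
    P.IsStationary model ε (tr.post n).x (tr.post n).y

/-- In the transient model, the penalty `ρ = 2 θ` dominates the curvature of the temperature
constraints: `ρ ≥ 2 C Λ`. -/
def PenaltyCondition (C : ℝ≥0) : Prop :=
  model = .transient → ∀ n, tr.Running P model par ε n → 2 * (C : ℝ) * tr.Λ n ≤ 2 * tr.θ n

end Trace

end algorithm

end DLR

end

/-!
Along a run the `u`-update keeps `v = -w - θ u`, and with `r = A x + B y` the augmented Lagrangian
becomes `C(x) - ⟪w, r⟫ + θ/2 ‖r‖² + θ/2 ‖r + u‖²`, which is bounded below because the generation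
cost is bounded on `X` and `w` stays bounded.

*One inner iteration.* Let `d` be the gradient of the augmented Lagrangian in `B y` at the new
point `y⁺`. The KKT system gives `⟪d, B y - B y⁺⟫ ≥ -θ/2 ‖B y - B y⁺‖²` for all `y ∈ Y`
(`IsYKKT.inner_ge`): in the transient model this is the quadratic lower bound for functions with
Lipschitz gradient together with `C Λ ≤ θ`; in the steady-state model no curvature term is needed,
since the temperature of a time is increasing in the current of that time. The inequality shows
both that `-Bᵀ d` is a proximal normal to `Y`, and that an iteration decreases the augmented
Lagrangian by `θ/2 ‖Δ(B y)‖² + θ ‖Δu‖²` (`InnerStep.descent`). All stationarity residuals are at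
most multiples of `θ (‖Δ(B y)‖ + ‖Δu‖)` and `‖Δu‖`, so that an iteration that does not end its
loop decreases the augmented Lagrangian by a multiple of `ε² / θ` (`InnerStep.decrease`).

*All inner loops.* A loop that is not the last one ends with `‖u‖ > (1 - κ) ε`. Its end also
satisfies `θ ‖u‖² = O(1)` when the starting values of the augmented Lagrangian are bounded, and
`θ ‖u‖ = O(1)` when the outer duals are bounded; in the latter case warm starts have bounded
augmented Lagrangian. From `θ ‖u‖ ^ k = O(1)` the penalties are `O(1 / ε ^ k)`. While the penalty
stays the same the slacks decay geometrically, and otherwise the penalty grows geometrically;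
`iterations_le` sums the lengths of the loops without a logarithmic loss, which gives
`O(1 / ε ^ (2 + k))` iterations (`exists_rate`).

*Smoothness constants.* The heat equation on `[0, Δ]` is an equation between curves in the Banach
algebra `C([0, Δ])`. Its linearization is a Volterra equation, solvable by an integrating factor,
so by the inverse function theorem the final temperature is a `C²` function of the source and of
the initial temperature (`contDiffAt_heatFlow`). Comparison with a linear subsolution shows that
the temperature limit bounds the currents, and on a compact box a `C²` function has Lipschitz
gradient (`exists_isSmoothnessConst`).
-/

noncomputable section

namespace DLR

/-! ### The scalar heat equation: existence, uniqueness and bounds -/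

section autonomous

variable {g T S : ℝ → ℝ} {Δ : ℝ}

/-- A derivative within `[0, Δ]` is a right derivative at every point of `[0, Δ)`. -/
lemma hasDerivWithinAt_Ici_of_Icc {d : ℝ} {τ : ℝ} (hτ : τ ∈ Set.Ico 0 Δ)
    (h : HasDerivWithinAt T d (Set.Icc 0 Δ) τ) : HasDerivWithinAt T d (Set.Ici τ) τ := by
  refine (h.mono (Set.Icc_subset_Icc_left hτ.1)).mono_of_mem_nhdsWithin ?_
  exact Icc_mem_nhdsGE hτ.2

/-- A supersolution with a strict inequality wherever the two curves meet stays above. -/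
lemma fencing {T' S' : ℝ → ℝ}
    (hT : ∀ τ ∈ Set.Icc 0 Δ, HasDerivWithinAt T (T' τ) (Set.Icc 0 Δ) τ)
    (hS : ∀ τ ∈ Set.Icc 0 Δ, HasDerivWithinAt S (S' τ) (Set.Icc 0 Δ) τ)
    (h0 : T 0 ≤ S 0) (hlt : ∀ τ ∈ Set.Ico 0 Δ, T τ = S τ → T' τ < S' τ) :
    ∀ τ ∈ Set.Icc 0 Δ, T τ ≤ S τ :=
  image_le_of_deriv_right_lt_deriv_boundary' (fun τ hτ => (hT τ hτ).continuousWithinAt)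
    (fun τ hτ => hasDerivWithinAt_Ici_of_Icc hτ (hT τ ⟨hτ.1, hτ.2.le⟩)) h0
    (fun τ hτ => (hS τ hτ).continuousWithinAt)
    (fun τ hτ => hasDerivWithinAt_Ici_of_Icc hτ (hS τ ⟨hτ.1, hτ.2.le⟩)) hlt

lemma le_of_field_neg (hT : ∀ τ ∈ Set.Icc 0 Δ, HasDerivWithinAt T (g (T τ)) (Set.Icc 0 Δ) τ)
    {R : ℝ} (h0 : T 0 ≤ R) (hR : g R < 0) : ∀ τ ∈ Set.Icc 0 Δ, T τ ≤ R :=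
  fencing (S := fun _ => R) (S' := fun _ => 0) hT (fun τ _ => hasDerivWithinAt_const τ _ R) h0
    fun τ _ h => by rwa [h]

lemma ge_of_field_pos (hT : ∀ τ ∈ Set.Icc 0 Δ, HasDerivWithinAt T (g (T τ)) (Set.Icc 0 Δ) τ)
    {R : ℝ} (h0 : R ≤ T 0) (hR : 0 < g R) : ∀ τ ∈ Set.Icc 0 Δ, R ≤ T τ :=
  fencing (T := fun _ => R) (T' := fun _ => 0) (fun τ _ => hasDerivWithinAt_const τ _ R) hT h0
    fun τ _ h => by rwa [← h]

/-- Global existence for a vector field that is Lipschitz and bounded on the whole line. -/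
lemma exists_solution_of_bounded (hΔ : 0 ≤ Δ) {K L : ℝ≥0} (hg : LipschitzWith K g)
    (hL : ∀ s, |g s| ≤ L) (T0 : ℝ) :
    ∃ T : ℝ → ℝ, T 0 = T0 ∧
      ∀ τ ∈ Set.Icc 0 Δ, HasDerivWithinAt T (g (T τ)) (Set.Icc 0 Δ) τ := by
  have h : IsPicardLindelof (fun _ => g) (⟨0, le_rfl, hΔ⟩ : Set.Icc 0 Δ) T0
      (L * Δ.toNNReal) 0 L K := by
    refine IsPicardLindelof.of_time_independent (fun x _ => hL x) hg.lipschitzOnWith ?_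
    simp [hΔ]
  exact h.exists_eq_forall_mem_Icc_hasDerivWithinAt₀

end autonomous

section heat

variable {K4 K1 K0 Δ T0 : ℝ} {T S : ℝ → ℝ}

lemma locallyLipschitz_heatField (K4 K1 K0 : ℝ) :
    LocallyLipschitz fun s : ℝ => -K4 * s ^ 4 - K1 * s + K0 := by
  have : ContDiff ℝ 1 fun s : ℝ => -K4 * s ^ 4 - K1 * s + K0 := by fun_prop
  exact this.locallyLipschitz

lemma IsHeatSolution.continuousOn (hT : IsHeatSolution K4 K1 K0 Δ T0 T) :
    ContinuousOn T (Set.Icc 0 Δ) :=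
  fun τ hτ => (hT.2 τ hτ).continuousWithinAt

lemma IsHeatSolution.eqOn (hT : IsHeatSolution K4 K1 K0 Δ T0 T)
    (hS : IsHeatSolution K4 K1 K0 Δ T0 S) : Set.EqOn T S (Set.Icc 0 Δ) := by
  have hc : IsCompact (T '' Set.Icc 0 Δ ∪ S '' Set.Icc 0 Δ) :=
    (isCompact_Icc.image_of_continuousOn hT.continuousOn).union
      (isCompact_Icc.image_of_continuousOn hS.continuousOn)
  obtain ⟨K, hK⟩ := ((locallyLipschitz_heatField K4 K1 K0).locallyLipschitzOn
    (s := T '' Set.Icc 0 Δ ∪ S '' Set.Icc 0 Δ)).exists_lipschitzOnWith_of_compact hc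
  refine ODE_solution_unique_of_mem_Icc_right
    (v := fun _ s => -K4 * s ^ 4 - K1 * s + K0) (fun _ _ => hK) hT.continuousOn
    (fun τ hτ => hasDerivWithinAt_Ici_of_Icc hτ (hT.2 τ ⟨hτ.1, hτ.2.le⟩))
    (fun τ hτ => .inl ⟨τ, ⟨hτ.1, hτ.2.le⟩, rfl⟩) hS.continuousOn
    (fun τ hτ => hasDerivWithinAt_Ici_of_Icc hτ (hS.2 τ ⟨hτ.1, hτ.2.le⟩))
    (fun τ hτ => .inr ⟨τ, ⟨hτ.1, hτ.2.le⟩, rfl⟩) (hT.1.trans hS.1.symm)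

/-- The heat equation is solvable on `[0, Δ]`: truncating the temperature to `[0, R]` makes the
vector field bounded and Lipschitz, and for large `R` the truncated solution stays in `[0, R]`. -/
lemma exists_isHeatSolution (hK1 : 0 < K1) (hK4 : 0 ≤ K4) (hK0 : 0 < K0) (hΔ : 0 ≤ Δ)
    (hT0 : 0 ≤ T0) : ∃ T, IsHeatSolution K4 K1 K0 Δ T0 T := by
  obtain ⟨R, hR0, hR1⟩ : ∃ R, T0 ≤ R ∧ (K0 + 1) / K1 ≤ R :=
    ⟨max T0 ((K0 + 1) / K1), le_max_left _ _, le_max_right _ _⟩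
  have hR : 0 ≤ R := hT0.trans hR0
  set f : ℝ → ℝ := fun s => -K4 * s ^ 4 - K1 * s + K0 with hf
  set c : ℝ → ℝ := fun s => max 0 (min R s) with hcdef
  have hcR : ∀ s, c s ∈ Set.Icc 0 R := fun s => ⟨le_max_left _ _, max_le hR (min_le_left _ _)⟩
  have hc : LipschitzWith 1 c := (LipschitzWith.id.const_min R).const_max 0
  obtain ⟨K, hK⟩ := ((locallyLipschitz_heatField K4 K1 K0).locallyLipschitzOn
    (s := Set.Icc 0 R)).exists_lipschitzOnWith_of_compact isCompact_Icc
  have hfc : LipschitzWith (K * 1) (fun s => f (c s)) := by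
    rw [← lipschitzOnWith_univ]
    exact hK.comp hc.lipschitzOnWith fun s _ => hcR s
  obtain ⟨L, hL⟩ := isCompact_Icc.exists_bound_of_continuousOn (s := Set.Icc 0 R) (f := f)
    (by fun_prop)
  obtain ⟨T, hT, hT'⟩ := exists_solution_of_bounded hΔ hfc (L := L.toNNReal)
    (fun s => (hL _ (hcR s)).trans (Real.le_coe_toNNReal L)) T0
  have hup : ∀ τ ∈ Set.Icc 0 Δ, T τ ≤ R := by
    refine le_of_field_neg (g := fun s => f (c s)) hT' (hT ▸ hR0) ?_
    have h1 : K0 + 1 ≤ R * K1 := (div_le_iff₀ hK1).1 hR1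
    have h2 : 0 ≤ K4 * R ^ 4 := by positivity
    simp only [hcdef, hf, min_self, max_eq_right hR]
    linarith
  have hlo : ∀ τ ∈ Set.Icc 0 Δ, 0 ≤ T τ := by
    refine ge_of_field_pos (g := fun s => f (c s)) hT' (hT ▸ hT0) ?_
    simpa [hcdef, hf, hR] using hK0
  refine ⟨T, hT, fun τ hτ => ?_⟩
  have h := hT' τ hτ
  rwa [show c (T τ) = T τ by simp [hcdef, hup τ hτ, hlo τ hτ]] at h

/-- `heatFlow` is the final value of any solution. -/
lemma IsHeatSolution.heatFlow_eq (hΔ : 0 ≤ Δ) (hT : IsHeatSolution K4 K1 K0 Δ T0 T) :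
    heatFlow K4 K1 K0 Δ T0 = T Δ := by
  have h : ∃ T, IsHeatSolution K4 K1 K0 Δ T0 T := ⟨T, hT⟩
  rw [heatFlow, dif_pos h]
  exact h.choose_spec.eqOn hT ⟨hΔ, le_rfl⟩

lemma heatFlow_pos (hK1 : 0 < K1) (hK4 : 0 ≤ K4) (hK0 : 0 < K0) (hΔ : 0 ≤ Δ) (hT0 : 0 < T0) :
    0 < heatFlow K4 K1 K0 Δ T0 := by
  obtain ⟨T, hT⟩ := exists_isHeatSolution hK1 hK4 hK0 hΔ hT0.le
  -- A small constant is a strict subsolution, since the field is positive near `0`.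
  have hev : ∀ᶠ s in 𝓝[>] (0 : ℝ), 0 < -K4 * s ^ 4 - K1 * s + K0 := by
    refine nhdsWithin_le_nhds (ContinuousAt.eventually_lt (by fun_prop) (by fun_prop) ?_)
    simpa using hK0
  obtain ⟨s, ⟨hs, hs1⟩, hs0⟩ := (hev.and (nhdsWithin_le_nhds (gt_mem_nhds hT0))).and
    self_mem_nhdsWithin |>.exists
  rw [hT.heatFlow_eq hΔ]
  exact lt_of_lt_of_le hs0
    (ge_of_field_pos (g := fun s => -K4 * s ^ 4 - K1 * s + K0) hT.2 (hT.1 ▸ hs1.le) hs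
      Δ ⟨hΔ, le_rfl⟩)

/-- A large heat source produces a large final temperature: the line from `0` to `R` is a strict
subsolution. -/
lemma lt_source_imp_le_heatFlow (hK1 : 0 < K1) (hK4 : 0 ≤ K4) (hΔ : 0 < Δ) (hT0 : 0 ≤ T0)
    {R : ℝ} (hR : 0 ≤ R) (hK0 : R / Δ + K1 * R + K4 * R ^ 4 < K0) :
    R ≤ heatFlow K4 K1 K0 Δ T0 := by
  have hK0' : 0 < K0 := lt_of_le_of_lt (by positivity) hK0
  obtain ⟨T, hT⟩ := exists_isHeatSolution hK1 hK4 hK0' hΔ.le hT0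
  rw [hT.heatFlow_eq hΔ.le]
  have key := fencing (T := fun τ => R / Δ * τ) (T' := fun _ => R / Δ) (S := T)
    (fun τ _ => by simpa using (hasDerivWithinAt_id τ (Set.Icc 0 Δ)).const_mul (R / Δ)) hT.2
    (by simpa [hT.1] using hT0) (fun τ hτ heq => ?_) Δ ⟨hΔ.le, le_rfl⟩
  · rwa [div_mul_cancel₀ _ hΔ.ne'] at key
  · have h1 : 0 ≤ T τ := by rw [← heq]; exact mul_nonneg (by positivity) hτ.1
    have h2 : T τ ≤ R := by
      rw [← heq, div_mul_eq_mul_div, div_le_iff₀ hΔ]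
      exact mul_le_mul_of_nonneg_left hτ.2.le hR
    have h3 : K1 * T τ ≤ K1 * R := by gcongr
    have h4 : K4 * T τ ^ 4 ≤ K4 * R ^ 4 := by gcongr
    show R / Δ < _
    linarith

end heat

/-! ### Smooth dependence of the heat flow on the source and on the initial temperature -/

section volterra

variable {Δ : ℝ}

/-- Continuous real functions on `[0, Δ]`, a Banach algebra. -/
abbrev Curve (Δ : ℝ) := C(Set.Icc (0 : ℝ) Δ, ℝ)

/-- Extension of a curve to the line by its end values. -/
def Curve.ext (hΔ : 0 ≤ Δ) (h : Curve Δ) : ℝ → ℝ := Set.IccExtend hΔ h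

lemma Curve.continuous_ext (hΔ : 0 ≤ Δ) (h : Curve Δ) : Continuous (h.ext hΔ) :=
  h.continuous.Icc_extend'

lemma Curve.ext_apply (hΔ : 0 ≤ Δ) (h : Curve Δ) {τ : ℝ} (hτ : τ ∈ Set.Icc 0 Δ) :
    h.ext hΔ τ = h ⟨τ, hτ⟩ := Set.IccExtend_of_mem hΔ h hτ

/-- The Volterra operator `h ↦ ∫₀ h` on curves. -/
def volterra (hΔ : 0 ≤ Δ) : Curve Δ →L[ℝ] Curve Δ :=
  LinearMap.mkContinuous
    { toFun := fun h => ⟨fun τ => ∫ s in (0 : ℝ)..τ, h.ext hΔ s,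
        (intervalIntegral.continuous_primitive
          (fun a b => (h.continuous_ext hΔ).intervalIntegrable a b) 0).comp
          continuous_subtype_val⟩
      map_add' := fun h k => by
        ext τ
        exact intervalIntegral.integral_add ((h.continuous_ext hΔ).intervalIntegrable _ _)
          ((k.continuous_ext hΔ).intervalIntegrable _ _)
      map_smul' := fun c h => by
        ext τ
        exact intervalIntegral.integral_const_mul c _ }
    Δ (fun h => by
      refine (ContinuousMap.norm_le _ (by positivity)).2 fun τ => ?_
      refine (intervalIntegral.norm_integral_le_of_norm_le_const (C := ‖h‖)
        fun s _ => h.norm_coe_le_norm _).trans ?_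
      rw [sub_zero, abs_of_nonneg τ.2.1, mul_comm]
      exact mul_le_mul_of_nonneg_right τ.2.2 (norm_nonneg _))

lemma volterra_apply (hΔ : 0 ≤ Δ) (h : Curve Δ) (τ : Set.Icc (0 : ℝ) Δ) :
    volterra hΔ h τ = ∫ s in (0 : ℝ)..τ, h.ext hΔ s := rfl

/-- `volterra h` is the primitive of `h` that vanishes at `0`. -/
lemma hasDerivWithinAt_ext_volterra (hΔ : 0 ≤ Δ) (h : Curve Δ) {τ : ℝ} (hτ : τ ∈ Set.Icc 0 Δ) :
    HasDerivWithinAt ((volterra hΔ h).ext hΔ) (h ⟨τ, hτ⟩) (Set.Icc 0 Δ) τ := by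
  have h1 : HasDerivAt (fun t => ∫ s in (0 : ℝ)..t, h.ext hΔ s) (h.ext hΔ τ) τ :=
    (h.continuous_ext hΔ).integral_hasStrictDerivAt 0 τ |>.hasDerivAt
  rw [← h.ext_apply hΔ hτ]
  refine h1.hasDerivWithinAt.congr (fun t ht => ?_) ?_
  · rw [Curve.ext_apply hΔ _ ht, volterra_apply]
  · rw [Curve.ext_apply hΔ _ hτ, volterra_apply]

/-- A curve with derivative `h` that vanishes at `0` is `volterra h`. -/
lemma eq_volterra (hΔ : 0 ≤ Δ) {F h : Curve Δ} (h0 : F ⟨0, le_rfl, hΔ⟩ = 0)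
    (hF : ∀ τ (hτ : τ ∈ Set.Icc 0 Δ),
      HasDerivWithinAt (F.ext hΔ) (h ⟨τ, hτ⟩) (Set.Icc 0 Δ) τ) : F = volterra hΔ h := by
  have key : ∀ x ∈ Set.Icc 0 Δ, (F.ext hΔ - (volterra hΔ h).ext hΔ) x = 0 := by
    refine eq_zero_of_abs_deriv_le_mul_abs_self_of_eq_zero_right (f' := fun _ => 0) (K := 0)
      ((F.continuous_ext hΔ).sub ((volterra hΔ h).continuous_ext hΔ)).continuousOn
      (fun τ hτ => ?_) ?_ (by simp)
    · have := (hF τ ⟨hτ.1, hτ.2.le⟩).sub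
        (hasDerivWithinAt_ext_volterra hΔ h (τ := τ) ⟨hτ.1, hτ.2.le⟩)
      rw [sub_self] at this
      exact hasDerivWithinAt_Ici_of_Icc hτ this
    · simp [Curve.ext_apply hΔ _ (show (0 : ℝ) ∈ Set.Icc 0 Δ from ⟨le_rfl, hΔ⟩), h0,
        volterra_apply]
  ext τ
  simpa [Curve.ext_apply hΔ _ τ.2, sub_eq_zero] using key τ τ.2

/-- The linear Volterra equation `δ + ∫₀ a δ = h` has exactly one solution: uniqueness is
Grönwall's inequality, existence the integrating factor `exp (∫₀ a)`. -/
lemma volterra_equation_bijective (hΔ : 0 ≤ Δ) (a : Curve Δ) :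
    Function.Bijective fun δ : Curve Δ => δ + volterra hΔ (a * δ) := by
  constructor
  · suffices H : ∀ δ : Curve Δ, δ + volterra hΔ (a * δ) = 0 → δ = 0 by
      intro δ₁ δ₂ h
      refine sub_eq_zero.1 (H _ ?_)
      simp only [mul_sub, map_sub] at h ⊢
      linear_combination h
    intro δ h
    have hδ : δ = volterra hΔ (-(a * δ)) := by rw [map_neg]; linear_combination h
    have key : ∀ x ∈ Set.Icc 0 Δ, δ.ext hΔ x = 0 := by
      refine eq_zero_of_abs_deriv_le_mul_abs_self_of_eq_zero_right
        (f' := fun s => -((a * δ).ext hΔ s)) (K := ‖a‖)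
        (δ.continuous_ext hΔ).continuousOn (fun τ hτ => ?_) ?_ (fun τ hτ => ?_)
      · have := hasDerivWithinAt_ext_volterra hΔ (-(a * δ)) (τ := τ) ⟨hτ.1, hτ.2.le⟩
        rw [← hδ] at this
        rw [Curve.ext_apply hΔ _ ⟨hτ.1, hτ.2.le⟩]
        exact hasDerivWithinAt_Ici_of_Icc hτ this
      · rw [Curve.ext_apply hΔ _ ⟨le_rfl, hΔ⟩, hδ, volterra_apply]
        simp
      · rw [norm_neg, Curve.ext_apply hΔ _ ⟨hτ.1, hτ.2.le⟩, Curve.ext_apply hΔ _ ⟨hτ.1, hτ.2.le⟩,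
          ContinuousMap.mul_apply, norm_mul]
        exact mul_le_mul_of_nonneg_right (a.norm_coe_le_norm _) (norm_nonneg _)
    ext τ
    simpa [Curve.ext_apply hΔ _ τ.2] using key τ τ.2
  · intro h
    -- `z = exp (-A) ∫₀ exp A a h` solves `z' = a (h - z)`, so `h - z` is the solution.
    set A : Curve Δ := volterra hΔ a with hA
    let e : Curve Δ := ⟨fun τ => Real.exp (A τ), by fun_prop⟩
    let e' : Curve Δ := ⟨fun τ => Real.exp (-A τ), by fun_prop⟩
    set z : Curve Δ := e' * volterra hΔ (e * (a * h)) with hz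
    have hzv : z = volterra hΔ (a * (h - z)) := by
      refine eq_volterra hΔ ?_ fun τ hτ => ?_
      · simp [hz, volterra_apply]
      · have h1 := (hasDerivWithinAt_ext_volterra hΔ a hτ).neg.exp
        have h2 := h1.mul (hasDerivWithinAt_ext_volterra hΔ (e * (a * h)) hτ)
        refine (h2.congr_deriv ?_).congr (fun t ht => ?_) ?_
        · have hee : Real.exp (-A ⟨τ, hτ⟩) * Real.exp (A ⟨τ, hτ⟩) = 1 := by
            rw [← Real.exp_add]; simp
          simp only [Curve.ext_apply hΔ _ hτ, Pi.neg_apply, ContinuousMap.mul_apply,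
            ContinuousMap.sub_apply, hz, e, e', ContinuousMap.coe_mk, ← hA]
          linear_combination a ⟨τ, hτ⟩ * h ⟨τ, hτ⟩ * hee
        · simp [Curve.ext_apply hΔ _ ht, hz, e', hA]
        · simp [Curve.ext_apply hΔ _ hτ, hz, e', hA]
    refine ⟨h - z, ?_⟩
    show h - z + volterra hΔ (a * (h - z)) = h
    rw [← hzv]
    ring

end volterra

section flow

variable {Δ : ℝ}

/-- The heat equation as an equation between curves: the first component of
`heatMap (T, K₀)` is `T - ∫₀ (K₀ - K₁ T - K₄ T⁴)`, which is the constant `T₀` exactly for the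
solution started at `T₀`. The second component `K₀` makes the map locally invertible. -/
def heatMap (hΔ : 0 ≤ Δ) (K4 K1 : ℝ) (p : Curve Δ × ℝ) : Curve Δ × ℝ :=
  (p.1 - volterra hΔ (p.2 • 1 - K1 • p.1 - K4 • p.1 ^ 4), p.2)

lemma contDiff_heatMap (hΔ : 0 ≤ Δ) (K4 K1 : ℝ) {n : WithTop ℕ∞} :
    ContDiff ℝ n (heatMap hΔ K4 K1) := by
  unfold heatMap
  fun_prop

lemma exists_hasFDerivAt_heatMap_equiv (hΔ : 0 ≤ Δ) (K4 K1 : ℝ) (p : Curve Δ × ℝ) :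
    ∃ D : (Curve Δ × ℝ) ≃L[ℝ] (Curve Δ × ℝ),
      HasFDerivAt (heatMap hΔ K4 K1) (D : (Curve Δ × ℝ) →L[ℝ] (Curve Δ × ℝ)) p := by
  set J := volterra hΔ
  let pr := ContinuousLinearMap.fst ℝ (Curve Δ) ℝ
  let D : (Curve Δ × ℝ) →L[ℝ] (Curve Δ × ℝ) :=
    (pr - J.comp ((ContinuousLinearMap.snd ℝ (Curve Δ) ℝ).smulRight 1 - K1 • pr
      - K4 • ((4 • p.1 ^ 3) • pr))).prod (ContinuousLinearMap.snd ℝ (Curve Δ) ℝ)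
  have hD : HasFDerivAt (heatMap hΔ K4 K1) D p := by
    have h4 : HasFDerivAt (fun q : Curve Δ × ℝ => q.1 ^ 4) ((4 • p.1 ^ 3) • pr) p := by
      simpa using (hasFDerivAt_fst (𝕜 := ℝ) (p := p)).pow 4
    have hin := ((((ContinuousLinearMap.snd ℝ (Curve Δ) ℝ).smulRight
      (1 : Curve Δ)).hasFDerivAt (x := p)).sub
      ((hasFDerivAt_fst (𝕜 := ℝ) (p := p)).const_smul K1)).sub (h4.const_smul K4)
    exact (hasFDerivAt_fst.sub (J.hasFDerivAt.comp p hin)).prodMk hasFDerivAt_snd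
  let a : Curve Δ := K1 • 1 + K4 • (4 • p.1 ^ 3)
  have hDa : ∀ q : Curve Δ × ℝ, D q = (q.1 + J (a * q.1) - q.2 • J 1, q.2) := by
    intro q
    have : (q.2 • (1 : Curve Δ) - K1 • q.1 - K4 • ((4 • p.1 ^ 3) • q.1))
        = q.2 • 1 - a * q.1 := by
      ext τ
      simp [a]
      ring
    show (q.1 - J (q.2 • (1 : Curve Δ) - K1 • q.1 - K4 • ((4 • p.1 ^ 3) • q.1)), q.2) = _
    rw [this, map_sub, map_smul]
    congr 1
    abel
  have hbij : Function.Bijective D := by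
    obtain ⟨hinj, hsurj⟩ := volterra_equation_bijective hΔ a
    constructor
    · intro q r hqr
      rw [hDa, hDa, Prod.mk.injEq] at hqr
      obtain ⟨h1, h2⟩ := hqr
      rw [h2] at h1
      exact Prod.ext (hinj (sub_left_injective h1)) h2
    · rintro ⟨h, k⟩
      obtain ⟨δ, hδ⟩ := hsurj (h + k • J 1)
      refine ⟨(δ, k), ?_⟩
      rw [hDa]
      exact Prod.ext (by simpa [sub_eq_iff_eq_add] using hδ) rfl
  refine ⟨ContinuousLinearEquiv.ofBijective D (LinearMap.ker_eq_bot.2 hbij.1)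
    (LinearMap.range_eq_top.2 hbij.2), ?_⟩
  rwa [ContinuousLinearEquiv.coe_ofBijective]

/-- Curves that solve the integral equation solve the heat equation. -/
lemma isHeatSolution_of_heatMap_eq (hΔ : 0 ≤ Δ) {K4 K1 K0 T0 : ℝ} {T : Curve Δ}
    (h : T - volterra hΔ (K0 • 1 - K1 • T - K4 • T ^ 4) = ContinuousMap.const _ T0) :
    IsHeatSolution K4 K1 K0 Δ T0 (T.ext hΔ) := by
  have hT : T = ContinuousMap.const _ T0 + volterra hΔ (K0 • 1 - K1 • T - K4 • T ^ 4) :=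
    sub_eq_iff_eq_add.1 h
  refine ⟨?_, fun τ hτ => ?_⟩
  · rw [Curve.ext_apply hΔ _ ⟨le_rfl, hΔ⟩, hT]
    simp [volterra_apply]
  · have h1 := (hasDerivWithinAt_ext_volterra hΔ (K0 • 1 - K1 • T - K4 • T ^ 4) hτ).const_add T0
    refine (h1.congr_deriv ?_).congr (fun t ht => ?_) ?_
    · simp [Curve.ext_apply hΔ _ hτ]
      ring
    · rw [Curve.ext_apply hΔ _ ht, Curve.ext_apply hΔ _ ht]
      exact congrArg (fun F : Curve Δ => F ⟨t, ht⟩) hT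
    · rw [Curve.ext_apply hΔ _ hτ, Curve.ext_apply hΔ _ hτ]
      exact congrArg (fun F : Curve Δ => F ⟨τ, hτ⟩) hT

lemma IsHeatSolution.exists_heatMap_eq (hΔ : 0 ≤ Δ) {K4 K1 K0 T0 : ℝ} {T : ℝ → ℝ}
    (hT : IsHeatSolution K4 K1 K0 Δ T0 T) :
    ∃ F : Curve Δ, heatMap hΔ K4 K1 (F, K0) = (ContinuousMap.const _ T0, K0) := by
  obtain ⟨F, hF⟩ : ∃ F : Curve Δ, ∀ τ (hτ : τ ∈ Set.Icc 0 Δ), F ⟨τ, hτ⟩ = T τ :=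
    ⟨⟨fun τ => T τ, continuousOn_iff_continuous_domRestrict.1 hT.continuousOn⟩, fun _ _ => rfl⟩
  refine ⟨F, Prod.ext ?_ rfl⟩
  have : F - ContinuousMap.const _ T0 = volterra hΔ (K0 • 1 - K1 • F - K4 • F ^ 4) := by
    refine eq_volterra hΔ (sub_eq_zero.2 ((hF 0 ⟨le_rfl, hΔ⟩).trans hT.1)) fun τ hτ => ?_
    refine (((hT.2 τ hτ).sub_const T0).congr_deriv ?_).congr (fun t ht => ?_) ?_
    · simp [hF]
      ring
    · simp [hF, Curve.ext_apply hΔ _ ht]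
    · simp [hF, Curve.ext_apply hΔ _ hτ]
  show F - volterra hΔ (K0 • 1 - K1 • F - K4 • F ^ 4) = _
  rw [← this]
  abel

/-- The heat flow is a smooth function of the source `K₀` and the initial temperature `T₀`:
near a given solution it is the final value of the local inverse of `heatMap`. -/
lemma contDiffAt_heatFlow {K4 K1 K0 T0 : ℝ} (hΔ : 0 ≤ Δ) (hK1 : 0 < K1) (hK4 : 0 ≤ K4)
    (hK0 : 0 < K0) (hT0 : 0 ≤ T0) :
    ContDiffAt ℝ 2 (fun p : ℝ × ℝ => heatFlow K4 K1 p.1 Δ p.2) (K0, T0) := by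
  obtain ⟨T, hT⟩ := exists_isHeatSolution hK1 hK4 hK0 hΔ hT0
  obtain ⟨F, hF⟩ := hT.exists_heatMap_eq hΔ
  obtain ⟨D, hD⟩ := exists_hasFDerivAt_heatMap_equiv hΔ K4 K1 (F, K0)
  have hc : ContDiffAt ℝ 2 (heatMap hΔ K4 K1) (F, K0) := (contDiff_heatMap hΔ K4 K1).contDiffAt
  have hinv := hc.to_localInverse hD two_ne_zero
  set Ψ := hc.localInverse hD two_ne_zero
  rw [hF] at hinv
  have hright : ∀ᶠ y in 𝓝 (heatMap hΔ K4 K1 (F, K0)), heatMap hΔ K4 K1 (Ψ y) = y :=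
    (hc.hasStrictFDerivAt' hD two_ne_zero).eventually_right_inverse
  rw [hF] at hright
  let ι : ℝ × ℝ → Curve Δ × ℝ := fun p => (p.2 • 1, p.1)
  have hι : ContDiff ℝ 2 ι := by fun_prop
  have hι0 : ι (K0, T0) = (ContinuousMap.const _ T0, K0) := by
    refine Prod.ext ?_ rfl
    ext τ
    simp [ι]
  rw [← hι0] at hinv hright
  have hfst : ContDiffAt ℝ 2 (fun p => (Ψ (ι p)).1 ⟨Δ, hΔ, le_rfl⟩) (K0, T0) := by
    have h1 : ContDiffAt ℝ 2 (fun p => (Ψ (ι p)).1) (K0, T0) :=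
      contDiff_fst.contDiffAt.comp _ (hinv.comp (K0, T0) hι.contDiffAt)
    exact (ContinuousMap.evalCLM ℝ (⟨Δ, hΔ, le_rfl⟩ : Set.Icc 0 Δ)).contDiff.contDiffAt.comp _ h1
  refine hfst.congr_of_eventuallyEq ?_
  filter_upwards [hι.continuous.continuousAt.eventually hright] with p hp
  have h2 : (Ψ (ι p)).2 = p.1 := congrArg Prod.snd hp
  have h1 := congrArg Prod.fst hp
  have hsol : IsHeatSolution K4 K1 p.1 Δ p.2 ((Ψ (ι p)).1.ext hΔ) := by
    refine isHeatSolution_of_heatMap_eq hΔ ?_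
    rw [← h2]
    refine h1.trans ?_
    ext τ
    simp [ι]
  rw [hsol.heatFlow_eq hΔ, Curve.ext_apply hΔ _ ⟨hΔ, le_rfl⟩]

end flow

/-! ### Smoothness constants of the transient temperature maps -/

namespace Grid

section smoothness

variable {N G E : Type*} {H : ℕ} (P : Grid N G E H)

lemma K4_pos (l : E) : 0 < P.K4 l := by
  have := P.diam_pos l
  have := P.emiss_pos l
  have := P.sigma_pos
  have := P.mass_pos l
  have := P.heatCap_pos l
  have := Real.pi_pos
  unfold K4
  positivity

lemma K1_pos (l : E) (t : Fin H) : 0 < P.K1 l t :=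
  div_pos (P.kc_pos l t) (mul_pos (P.mass_pos l) (P.heatCap_pos l))

lemma K0_pos (l : E) (t : Fin H) {c : ℝ} (hc : 0 ≤ c) : 0 < P.K0 l t c :=
  div_pos (add_pos_of_pos_of_nonneg (P.source_pos l t) (mul_nonneg (P.resist_pos l).le hc))
    (mul_pos (P.mass_pos l) (P.heatCap_pos l))

lemma K0_strictMono (l : E) (t : Fin H) : StrictMono (P.K0 l t) := fun _ _ h =>
  div_lt_div_of_pos_right (add_lt_add_right (mul_lt_mul_of_pos_left h (P.resist_pos l)) _)
    (mul_pos (P.mass_pos l) (P.heatCap_pos l))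

lemma lt_K0 (l : E) (t : Fin H) (c : ℝ) :
    P.resist l / (P.mass l * P.heatCap l) * c < P.K0 l t c := by
  rw [div_mul_eq_mul_div]
  exact div_lt_div_of_pos_right (lt_add_of_pos_left _ (P.source_pos l t))
    (mul_pos (P.mass_pos l) (P.heatCap_pos l))

lemma transientTemp_succ (l : E) (t : Fin H) (iota : EuclideanSpace ℝ (Fin H)) :
    P.transientTemp l iota (t + 1) = heatFlow (P.K4 l) (P.K1 l t) (P.K0 l t (iota t)) P.Δ
      (P.transientTemp l iota t) := by
  rw [transientTemp, dif_pos t.2]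

lemma transientTemp_pos_and_contDiffAt (l : E) {iota : EuclideanSpace ℝ (Fin H)}
    (h : ∀ t, 0 ≤ iota t) (n : ℕ) :
    0 < P.transientTemp l iota n ∧ ContDiffAt ℝ 2 (fun z => P.transientTemp l z n) iota := by
  induction n with
  | zero => exact ⟨P.Tinit_pos l, contDiffAt_const⟩
  | succ n ih =>
    by_cases hn : n < H
    · simp only [transientTemp, dif_pos hn]
      have hK0 := P.K0_pos l ⟨n, hn⟩ (h ⟨n, hn⟩)
      refine ⟨heatFlow_pos (P.K1_pos l _) (P.K4_pos l).le hK0 P.Δ_pos.le ih.1, ?_⟩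
      have hf := contDiffAt_heatFlow P.Δ_pos.le (P.K1_pos l ⟨n, hn⟩) (P.K4_pos l).le hK0 ih.1.le
      have hg : ContDiffAt ℝ 2 (fun z : EuclideanSpace ℝ (Fin H) =>
          (P.K0 l ⟨n, hn⟩ (z ⟨n, hn⟩), P.transientTemp l z n)) iota := by
        refine ContDiffAt.prodMk ?_ ih.2
        unfold K0
        fun_prop
      exact hf.comp iota hg
    · simpa only [transientTemp, dif_neg hn] using ih

/-- The temperature limit bounds the squared currents of a line. -/
lemma exists_bound_admissibleCurrents (l : E) : ∃ M : Fin H → ℝ,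
    ∀ iota ∈ P.admissibleCurrents .transient l, ∀ t, iota t ≤ M t := by
  set R : ℝ := max P.Tmax 0 + 1
  have hR : 0 ≤ R := by positivity
  refine ⟨fun t => (R / P.Δ + P.K1 l t * R + P.K4 l * R ^ 4) /
    (P.resist l / (P.mass l * P.heatCap l)), fun iota hi t => ?_⟩
  have hr : 0 < P.resist l / (P.mass l * P.heatCap l) :=
    div_pos (P.resist_pos l) (mul_pos (P.mass_pos l) (P.heatCap_pos l))
  rw [le_div_iff₀ hr, mul_comm]
  refine (P.lt_K0 l t (iota t)).le.trans (not_lt.1 fun hlt => ?_)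
  have h1 := lt_source_imp_le_heatFlow (P.K1_pos l t) (P.K4_pos l).le P.Δ_pos
    (P.transientTemp_pos_and_contDiffAt l hi.1 t).1.le hR hlt
  rw [← transientTemp_succ] at h1
  have h2 : P.transientTemp l iota (t + 1) ≤ P.Tmax := hi.2 t
  have h3 : P.Tmax < R := (le_max_left _ _).trans_lt (lt_add_one _)
  linarith

/-- On a compact convex box containing the admissible currents the temperature maps are `C²`, so
their gradients are Lipschitz on the convex hull of the admissible currents. -/
lemma exists_isSmoothnessConst [Fintype E] : ∃ C : ℝ≥0, P.IsSmoothnessConst C := by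
  choose M hM using P.exists_bound_admissibleCurrents
  let box : E → Set (EuclideanSpace ℝ (Fin H)) := fun l => {z | ∀ t, z t ∈ Set.Icc 0 (M l t)}
  have hcomp : ∀ l, IsCompact (box l) := fun l => by
    have := (isCompact_univ_pi fun t : Fin H => isCompact_Icc (a := (0 : ℝ)) (b := M l t)).image
      (PiLp.continuous_toLp 2 fun _ : Fin H => ℝ)
    convert this using 1
    ext z
    refine ⟨fun hz => ⟨z.ofLp, fun t _ => hz t, rfl⟩, ?_⟩
    rintro ⟨z, hz, rfl⟩ t
    exact hz t trivial
  have hconv : ∀ l, Convex ℝ (box l) := fun l z hz z' hz' a b ha hb hab t =>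
    convex_Icc (0 : ℝ) (M l t) (hz t) (hz' t) ha hb hab
  have hhull : ∀ l, convexHull ℝ (P.admissibleCurrents .transient l) ⊆ box l := fun l =>
    convexHull_min (fun z hz t => ⟨hz.1 t, hM l z hz t⟩) (hconv l)
  have hsmooth : ∀ l (t : Fin H), ∀ z ∈ box l, ContDiffAt ℝ 2 (P.tempMap .transient l t) z :=
    fun l t z hz => (P.transientTemp_pos_and_contDiffAt l (fun s => (hz s).1) (t + 1)).2
  have hlip : ∀ l (t : Fin H), ∃ C, LipschitzOnWith C (fderiv ℝ (P.tempMap .transient l t))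
      (box l) := by
    intro l t
    refine LocallyLipschitzOn.exists_lipschitzOnWith_of_compact (hcomp l) fun z hz => ?_
    obtain ⟨C, s, hs, hC⟩ := ((hsmooth l t z hz).fderiv_right (m := 1)
      (by norm_num)).exists_lipschitzOnWith
    exact ⟨C, s, mem_nhdsWithin_of_mem_nhds hs, hC⟩
  choose C hC using hlip
  refine ⟨∑ l, ∑ t, C l t, fun l t => ⟨fun z hz =>
    (hsmooth l t z (hhull l hz)).differentiableAt two_ne_zero, ?_⟩⟩
  have h1 : LipschitzOnWith (1 * C l t) (gradient (P.tempMap .transient l t)) (box l) :=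
    (InnerProductSpace.toDual ℝ (EuclideanSpace ℝ (Fin H))).symm.lipschitz.comp_lipschitzOnWith
      (hC l t)
  refine (h1.weaken ?_).mono (hhull l)
  rw [one_mul]
  exact (Finset.single_le_sum (f := fun t => C l t) (fun _ _ => zero_le) (Finset.mem_univ t)).trans
    (Finset.single_le_sum (f := fun l => ∑ t, C l t) (fun _ _ => zero_le) (Finset.mem_univ l))

end smoothness

end Grid

/-! ### Consensus matrices and normal cones -/

lemma regularNormalCone_subset_normalCone {V : Type*} [NormedAddCommGroup V]
    [InnerProductSpace ℝ V] (S : Set V) (a : V) : regularNormalCone S a ⊆ normalCone S a :=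
  fun v hv => ⟨hv.1, fun _ => a, fun _ => v, fun _ => hv, tendsto_const_nhds, tendsto_const_nhds⟩

/-- Proximal normals are regular normals. -/
lemma mem_regularNormalCone_of_inner_le {V : Type*} [NormedAddCommGroup V]
    [InnerProductSpace ℝ V] {S : Set V} {a v : V} (ha : a ∈ S) {c : ℝ}
    (h : ∀ z ∈ S, ⟪v, z - a⟫ ≤ c * ‖z - a‖ ^ 2) : v ∈ regularNormalCone S a := by
  refine ⟨ha, fun b hb => ?_⟩
  have hev : ∀ᶠ z in 𝓝 a, c * ‖z - a‖ < b :=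
    ContinuousAt.eventually_lt (by fun_prop) (by fun_prop) (by simpa using hb)
  filter_upwards [nhdsWithin_le_nhds hev, self_mem_nhdsWithin] with z hz hzS
  calc ⟪v, z - a⟫ ≤ c * ‖z - a‖ ^ 2 := h z hzS
    _ = c * ‖z - a‖ * ‖z - a‖ := by ring
    _ ≤ b * ‖z - a‖ := mul_le_mul_of_nonneg_right hz.le (norm_nonneg _)

namespace Grid

section matrices

lemma act_sub {m n : Type*} [Fintype n] (M : Matrix m n ℝ) (z z' : EuclideanSpace ℝ n) :
    act M (z - z') = act M z - act M z' := by
  ext i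
  simp [act, Matrix.mulVec_sub]

variable {N G E : Type*} [Fintype G] [Fintype E] {H : ℕ}

lemma act_matA_transpose_inl (v : CVec G E H) (i : (G ⊕ E) × Fin H) :
    act (matA N G E H).transpose v (.inl i) = -v i := by
  simp [act, matA, Matrix.transpose_fromCols, Matrix.neg_mulVec]

lemma act_matA_transpose_inr (v : CVec G E H) (i : (G ⊕ N ⊕ N ⊕ E ⊕ E) × Fin H) :
    act (matA N G E H).transpose v (.inr i) = 0 := by
  simp [act, matA, Matrix.transpose_fromCols]

lemma act_matB_apply (y : YVec G E H) (i : (G ⊕ E) × Fin H) :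
    act (matB G E H) y i = y (.inl i) := by
  simp [act, matB, Matrix.fromCols_mulVec]

lemma act_matB_transpose_inl (v : CVec G E H) (i : (G ⊕ E) × Fin H) :
    act (matB G E H).transpose v (.inl i) = v i := by
  simp [act, matB, Matrix.transpose_fromCols]

lemma act_matB_transpose_inr (v : CVec G E H) (i : E × Fin H) :
    act (matB G E H).transpose v (.inr i) = 0 := by
  simp [act, matB, Matrix.transpose_fromCols]

lemma norm_act_matA_transpose [Fintype N] (v : CVec G E H) :
    ‖act (matA N G E H).transpose v‖ = ‖v‖ := by
  simp only [EuclideanSpace.norm_eq, Fintype.sum_sum_type, act_matA_transpose_inl,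
    act_matA_transpose_inr, norm_neg]
  simp

lemma norm_act_matB_transpose (v : CVec G E H) :
    ‖act (matB G E H).transpose v‖ = ‖v‖ := by
  simp only [EuclideanSpace.norm_eq, Fintype.sum_sum_type, act_matB_transpose_inl,
    act_matB_transpose_inr]
  simp

lemma norm_act_matB_le (y : YVec G E H) : ‖act (matB G E H) y‖ ≤ ‖y‖ := by
  simp only [EuclideanSpace.norm_eq, act_matB_apply]
  refine Real.sqrt_le_sqrt ?_
  rw [Fintype.sum_sum_type]
  exact le_add_of_nonneg_right (Finset.sum_nonneg fun _ _ => sq_nonneg _)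

lemma inner_act_matB_transpose (v : CVec G E H) (y : YVec G E H) :
    ⟪act (matB G E H).transpose v, y⟫ = ⟪v, act (matB G E H) y⟫ := by
  simp only [PiLp.inner_apply, Fintype.sum_sum_type, act_matB_transpose_inl,
    act_matB_transpose_inr, act_matB_apply]
  simp

end matrices

end Grid

/-! ### First-order inequalities for the temperature constraints -/

/-- The quadratic lower bound for a function with Lipschitz gradient. -/
lemma inner_gradient_le_of_lipschitzOnWith {V : Type*} [NormedAddCommGroup V]
    [InnerProductSpace ℝ V] [CompleteSpace V] {f : V → ℝ} {s : Set V} {C : ℝ≥0}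
    (hs : Convex ℝ s) (hd : ∀ z ∈ s, DifferentiableAt ℝ f z)
    (hl : LipschitzOnWith C (gradient f) s) {a b : V} (ha : a ∈ s) (hb : b ∈ s) :
    ⟪gradient f a, b - a⟫ ≤ f b - f a + C / 2 * ‖b - a‖ ^ 2 := by
  set h := b - a
  -- The claim is `φ 0 ≤ φ 1`, and the Lipschitz bound makes the derivative of `φ` nonnegative.
  let φ : ℝ → ℝ := fun τ => f (a + τ • h) - τ * ⟪gradient f a, h⟫ + C / 2 * ‖h‖ ^ 2 * τ ^ 2
  have hmem : ∀ τ ∈ Set.Icc (0 : ℝ) 1, a + τ • h ∈ s := fun τ hτ =>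
    hs.add_smul_sub_mem ha hb hτ
  have hφ : ∀ τ ∈ Set.Icc (0 : ℝ) 1, HasDerivAt φ
      (⟪gradient f (a + τ • h), h⟫ - ⟪gradient f a, h⟫ + C * ‖h‖ ^ 2 * τ) τ := by
    intro τ hτ
    have h1 : HasDerivAt (fun τ : ℝ => a + τ • h) h τ := by
      simpa using ((hasDerivAt_id τ).smul_const h).const_add a
    have h2 := (hd _ (hmem τ hτ)).hasGradientAt.hasFDerivAt.comp_hasDerivAt τ h1
    have h3 := (h2.sub ((hasDerivAt_id τ).mul_const ⟪gradient f a, h⟫)).add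
      ((hasDerivAt_pow 2 τ).const_mul (C / 2 * ‖h‖ ^ 2))
    refine h3.congr_deriv ?_
    simp
    ring
  have hmono : MonotoneOn φ (Set.Icc 0 1) := by
    refine monotoneOn_of_hasDerivWithinAt_nonneg (convex_Icc 0 1)
      (fun τ hτ => (hφ τ hτ).continuousAt.continuousWithinAt)
      (fun τ hτ => (hφ τ (interior_subset hτ)).hasDerivWithinAt) fun τ hτ => ?_
    have hτ' : τ ∈ Set.Icc (0 : ℝ) 1 := interior_subset hτ
    have h1 := hl.dist_le_mul _ (hmem τ hτ') _ ha
    rw [dist_eq_norm, dist_eq_norm, add_sub_cancel_left, norm_smul, Real.norm_of_nonneg hτ'.1]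
      at h1
    have h2 := neg_le_of_abs_le
      (abs_real_inner_le_norm (gradient f (a + τ • h) - gradient f a) h)
    rw [inner_sub_left] at h2
    have h3 := mul_le_mul_of_nonneg_right h1 (norm_nonneg h)
    nlinarith
  have := hmono (Set.left_mem_Icc.2 zero_le_one) (Set.right_mem_Icc.2 zero_le_one) zero_le_one
  have hab : a + h = b := add_sub_cancel a b
  simp only [φ, zero_smul, add_zero, zero_mul, sub_zero, one_smul, one_mul, one_pow, mul_one,
    hab, zero_pow two_ne_zero, mul_zero] at this
  linarith

/-- The gradient points away from directions along which the function does not exceed its value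
at the base point. Where the function is not differentiable, the gradient is `0` by
convention. -/
lemma inner_gradient_nonpos_of_segment_le {V : Type*} [NormedAddCommGroup V]
    [InnerProductSpace ℝ V] [CompleteSpace V] {f : V → ℝ} {a b : V}
    (h : ∀ z ∈ segment ℝ a b, f z ≤ f a) : ⟪gradient f a, b - a⟫ ≤ 0 := by
  by_cases hd : DifferentiableAt ℝ f a
  · have hmax : IsLocalMaxOn f (segment ℝ a b) a :=
      Filter.eventually_of_mem self_mem_nhdsWithin h
    have := hmax.hasFDerivWithinAt_nonpos hd.hasGradientAt.hasFDerivAt.hasFDerivWithinAt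
      (mem_posTangentConeAt_of_segment_subset (y := b - a) (by simp))
    simpa using this
  · rw [gradient, fderiv_zero_of_not_differentiableAt hd]
    simp

section steady

variable {K4 K1 : ℝ}

lemma steadyTemp_spec (hK4 : 0 < K4) (hK1 : 0 < K1) {K0 : ℝ} (hK0 : 0 < K0) :
    0 < steadyTemp K4 K1 K0 ∧
      K4 * steadyTemp K4 K1 K0 ^ 4 + K1 * steadyTemp K4 K1 K0 = K0 := by
  obtain ⟨s, hs, hs0⟩ : ∃ s ∈ Set.Icc 0 (K0 / K1), K4 * s ^ 4 + K1 * s = K0 := by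
    refine intermediate_value_Icc (by positivity) (by fun_prop) ⟨by simpa using hK0.le, ?_⟩
    rw [mul_div_cancel₀ _ hK1.ne']
    exact le_add_of_nonneg_left (by positivity)
  have hpos : 0 < s := by
    refine lt_of_le_of_ne hs.1 fun h => ?_
    rw [← h] at hs0
    simp at hs0
    exact hK0.ne hs0
  have hset : {s : ℝ | 0 < s ∧ K4 * s ^ 4 + K1 * s - K0 = 0} = {s} := by
    ext r
    simp only [Set.mem_ofPred_eq, Set.mem_singleton_iff]
    constructor
    · rintro ⟨hr, hr0⟩
      by_contra hne
      rcases lt_or_gt_of_ne hne with hlt | hlt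
      · have := pow_lt_pow_left₀ hlt hr.le (four_ne_zero)
        nlinarith
      · have := pow_lt_pow_left₀ hlt hpos.le (four_ne_zero)
        nlinarith
    · rintro rfl
      exact ⟨hpos, sub_eq_zero.2 hs0⟩
  have : steadyTemp K4 K1 K0 = s := by rw [steadyTemp, hset, csSup_singleton]
  rw [this]
  exact ⟨hpos, hs0⟩

lemma steadyTemp_le_iff (hK4 : 0 < K4) (hK1 : 0 < K1) {a b : ℝ} (ha : 0 < a) (hb : 0 < b) :
    steadyTemp K4 K1 a ≤ steadyTemp K4 K1 b ↔ a ≤ b := by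
  obtain ⟨ha0, ha1⟩ := steadyTemp_spec hK4 hK1 ha
  obtain ⟨hb0, hb1⟩ := steadyTemp_spec hK4 hK1 hb
  constructor
  · intro h
    rw [← ha1, ← hb1]
    gcongr
  · intro h
    by_contra! hlt
    have h1 : K4 * steadyTemp K4 K1 b ^ 4 < K4 * steadyTemp K4 K1 a ^ 4 := by gcongr
    have h2 : K1 * steadyTemp K4 K1 b < K1 * steadyTemp K4 K1 a := by gcongr
    linarith

end steady

namespace Grid

section lines

variable {N G E : Type*} {H : ℕ} (P : Grid N G E H)

/-- The constant of the quadratic error allowed for the temperature constraints in the first-order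
condition: the smoothness constant in the transient model, `0` in the steady-state model. -/
def curvature (model : TempModel) (C : ℝ≥0) : ℝ :=
  match model with
  | .steady => 0
  | .transient => C

/-- At an active temperature constraint, admissible directions do not increase the temperature to
first order, up to the curvature of the constraint. In the steady-state model the temperature
increases with the current of the same time and depends on no other, so that an admissible
competitor has a smaller current at an active constraint. -/
lemma inner_gradient_tempMap_le {model : TempModel} {C : ℝ≥0} (hC : P.IsSmoothnessConst C)
    {l : E} {t : Fin H} {a b : EuclideanSpace ℝ (Fin H)}
    (ha : a ∈ P.admissibleCurrents model l) (hb : b ∈ P.admissibleCurrents model l)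
    (hact : P.tempMap model l t a = P.Tmax) :
    ⟪gradient (P.tempMap model l t) a, b - a⟫ ≤ curvature model C / 2 * ‖b - a‖ ^ 2 := by
  cases model with
  | transient =>
    have := inner_gradient_le_of_lipschitzOnWith (convex_convexHull ℝ _) (hC l t).1 (hC l t).2
      (subset_convexHull ℝ _ ha) (subset_convexHull ℝ _ hb)
    have hbt := hb.2 t
    simp only [curvature]
    linarith
  | steady =>
    have hmono : ∀ {c d : EuclideanSpace ℝ (Fin H)}, 0 ≤ c t → 0 ≤ d t →
        (P.tempMap .steady l t c ≤ P.tempMap .steady l t d ↔ c t ≤ d t) := fun hc hd =>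
      (steadyTemp_le_iff (P.K4_pos l) (P.K1_pos l t) (P.K0_pos l t hc) (P.K0_pos l t hd)).trans
        (P.K0_strictMono l t).le_iff_le
    have hle : b t ≤ a t := (hmono (hb.1 t) (ha.1 t)).1 (hact ▸ hb.2 t)
    simp only [curvature, zero_div, zero_mul]
    refine inner_gradient_nonpos_of_segment_le ?_
    rintro z ⟨p, q, hp, hq, hpq, rfl⟩
    have hz : (p • a + q • b) t = p * a t + q * b t := by simp
    refine (hmono ?_ (ha.1 t)).2 ?_
    · rw [hz]
      exact add_nonneg (mul_nonneg hp (ha.1 t)) (mul_nonneg hq (hb.1 t))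
    · rw [hz]
      calc p * a t + q * b t ≤ p * a t + q * a t := by gcongr
        _ = a t := by rw [← add_mul, hpq, one_mul]

end lines

section kkt

variable {N G E : Type*} [Fintype N] [Fintype G] [Fintype E] {H : ℕ} {P : Grid N G E H}
  {model : TempModel} {C : ℝ≥0} {θ ρ : ℝ} {x : XVec N G E H} {y y' : YVec G E H}
  {u v : CVec G E H} {lam : E → Fin H → ℝ}

/-- A KKT point satisfies the first-order condition with respect to every feasible competitor up
to a quadratic error, provided that `θ` dominates the multipliers times the curvature. This makes
the negative gradient a proximal normal of `Y`, and the `y`-step a descent step. -/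
lemma IsYKKT.inner_ge (h : P.IsYKKT model ρ x y u v lam) (hC : P.IsSmoothnessConst C)
    (hlam : ∀ l, curvature model C * ∑ t, lam l t ≤ θ) (hθ : 0 ≤ θ) (hy' : y' ∈ P.Y model) :
    -(θ / 2 * ‖act (matB G E H) y' - act (matB G E H) y‖ ^ 2) ≤
      ⟪v + ρ • (gap x y + u), act (matB G E H) y' - act (matB G E H) y⟫ := by
  obtain ⟨hy, hline, hgen⟩ := h
  set d : CVec G E H := v + ρ • (gap x y + u)
  have hl : ∀ l, -(θ / 2 * ∑ s, (y'.iota l s - y.iota l s) ^ 2) ≤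
      ∑ s, d (.inr l, s) * (y'.iota l s - y.iota l s) := by
    intro l
    obtain ⟨hlamt, mu, hmu, hstat⟩ := hline l
    have ha := (hy.1 l).1
    have hb := (hy'.1 l).1
    set k := y'.iota l - y.iota l with hk
    have hkn : ‖k‖ ^ 2 = ∑ s, (y'.iota l s - y.iota l s) ^ 2 := by
      rw [EuclideanSpace.real_norm_sq_eq]
      rfl
    have h1 : ∀ t, lam l t * ⟪gradient (P.tempMap model l t) (y.iota l), k⟫ ≤
        lam l t * (curvature model C / 2 * ‖k‖ ^ 2) := by
      intro t
      rcases (hlamt t).1.eq_or_lt with h0 | h0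
      · simp [← h0]
      · refine mul_le_mul_of_nonneg_left (P.inner_gradient_tempMap_le hC ha hb ?_) h0.le
        exact sub_eq_zero.1 ((mul_eq_zero.1 (hlamt t).2).resolve_left h0.ne')
    have h2 : ∑ t, lam l t * ⟪gradient (P.tempMap model l t) (y.iota l), k⟫ ≤
        θ / 2 * ‖k‖ ^ 2 := by
      refine (Finset.sum_le_sum fun t _ => h1 t).trans ?_
      rw [← Finset.sum_mul]
      have := mul_le_mul_of_nonneg_right (hlam l) (by positivity : 0 ≤ ‖k‖ ^ 2 / 2)
      linarith
    have h3 : 0 ≤ ∑ s, mu s * (y'.iota l s - y.iota l s) := by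
      refine Finset.sum_nonneg fun s _ => ?_
      have := mul_nonneg (hmu s).1 (hb.1 s)
      rw [mul_sub, (hmu s).2]
      linarith
    have h4 : ∑ s, d (.inr l, s) * (y'.iota l s - y.iota l s) =
        ∑ s, mu s * (y'.iota l s - y.iota l s) -
          ∑ t, lam l t * ⟪gradient (P.tempMap model l t) (y.iota l), k⟫ := by
      have hsw : ∑ t, lam l t * ⟪gradient (P.tempMap model l t) (y.iota l), k⟫ =
          ∑ s, (∑ t, lam l t * (gradient (P.tempMap model l t) (y.iota l)) s) *
            (y'.iota l s - y.iota l s) := by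
        simp only [PiLp.inner_apply, Finset.mul_sum, Finset.sum_mul]
        rw [Finset.sum_comm]
        refine Finset.sum_congr rfl fun s _ => Finset.sum_congr rfl fun t _ => ?_
        simp [hk]
        ring
      rw [hsw, ← Finset.sum_sub_distrib]
      refine Finset.sum_congr rfl fun s _ => ?_
      rw [← sub_mul]
      congr 1
      linarith [hstat s]
    rw [h4, ← hkn]
    linarith
  have hg : ∀ g, 0 ≤ ∑ t, d (.inl g, t) * (y'.pG g t - y.pG g t) := fun g =>
    hgen g _ (hy'.2 g)
  have hsplit : ∀ F : (G ⊕ E) × Fin H → ℝ,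
      ∑ i, F i = ∑ g, ∑ t, F (.inl g, t) + ∑ l, ∑ t, F (.inr l, t) := fun F => by
    rw [Fintype.sum_prod_type, Fintype.sum_sum_type]
  have hinner : ⟪d, act (matB G E H) y' - act (matB G E H) y⟫ =
      ∑ g, ∑ t, d (.inl g, t) * (y'.pG g t - y.pG g t) +
        ∑ l, ∑ s, d (.inr l, s) * (y'.iota l s - y.iota l s) := by
    rw [PiLp.inner_apply, hsplit]
    simp [act_matB_apply, YVec.pG, YVec.iota, mul_comm]
  have hnorm : ‖act (matB G E H) y' - act (matB G E H) y‖ ^ 2 =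
      ∑ g, ∑ t, (y'.pG g t - y.pG g t) ^ 2 + ∑ l, ∑ s, (y'.iota l s - y.iota l s) ^ 2 := by
    rw [EuclideanSpace.real_norm_sq_eq, hsplit]
    simp [act_matB_apply, YVec.pG, YVec.iota]
  rw [hinner, hnorm]
  have h5 := Finset.sum_le_sum fun l (_ : l ∈ Finset.univ) => hl l
  rw [Finset.sum_neg_distrib, ← Finset.mul_sum] at h5
  have h6 := Finset.sum_nonneg fun g (_ : g ∈ Finset.univ) => hg g
  have h7 : 0 ≤ θ / 2 * ∑ g, ∑ t, (y'.pG g t - y.pG g t) ^ 2 := by positivity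
  linarith

lemma IsYKKT.neg_mem_normalCone (h : P.IsYKKT model ρ x y u v lam) (hC : P.IsSmoothnessConst C)
    (hlam : ∀ l, curvature model C * ∑ t, lam l t ≤ θ) (hθ : 0 ≤ θ) :
    -act (matB G E H).transpose (v + ρ • (gap x y + u)) ∈ normalCone (P.Y model) y := by
  refine regularNormalCone_subset_normalCone _ _
    (mem_regularNormalCone_of_inner_le h.1 (c := θ / 2) fun z hz => ?_)
  have h1 := h.inner_ge hC hlam hθ hz
  rw [← act_sub] at h1
  rw [inner_neg_left, inner_act_matB_transpose]
  have h2 : ‖act (matB G E H) (z - y)‖ ^ 2 ≤ ‖z - y‖ ^ 2 := by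
    gcongr
    exact norm_act_matB_le _
  nlinarith

end kkt

end Grid

/-! ### One inner iteration -/

namespace Grid

section bounds

variable {N G E : Type*} [Fintype N] [Fintype G] {H : ℕ} (P : Grid N G E H)

lemma exists_abs_cost_le : ∃ c : ℝ, 0 ≤ c ∧ ∀ x ∈ P.X, |P.cost x| ≤ c := by
  have hb : ∀ g, ∃ b, ∀ p ∈ Set.Icc (P.Pmin g) (P.Pmax g), ‖P.genCost g p‖ ≤ b := fun g =>
    isCompact_Icc.exists_bound_of_continuousOn (P.genCost_smooth g).continuous.continuousOn
  choose b hb using hb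
  refine ⟨∑ _t : Fin H, ∑ g, |b g|, by positivity, fun x hx => ?_⟩
  refine (Finset.abs_sum_le_sum_abs _ _).trans (Finset.sum_le_sum fun t _ => ?_)
  refine (Finset.abs_sum_le_sum_abs _ _).trans (Finset.sum_le_sum fun g _ => ?_)
  obtain ⟨-, -, -, -, hp, -⟩ := hx t
  exact (hb g _ (hp g)).trans (le_abs_self _)

variable [Fintype E]

/-- The augmented Lagrangian with the multiplier `v = -w - θ u` that the `u`-update produces. -/
lemma augLag_eq {w u v : CVec G E H} {θ : ℝ} (x : XVec N G E H) (y : YVec G E H)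
    (hv : w + θ • u = -v) :
    P.augLag w θ (2 * θ) x y u v = P.cost x - ⟪w, gap x y⟫ + θ / 2 * ‖gap x y‖ ^ 2 +
      θ / 2 * ‖gap x y + u‖ ^ 2 := by
  obtain rfl : v = -(w + θ • u) := by rw [hv, neg_neg]
  simp only [augLag, ← real_inner_self_eq_norm_sq, inner_add_left, inner_add_right,
    inner_neg_left, real_inner_smul_left, real_inner_comm u (gap x y)]
  ring

/-- Two residuals are controlled by the augmented Lagrangian, after absorbing the linear term. -/
lemma augLag_ge {w u v : CVec G E H} {θ : ℝ} (hθ : 0 < θ) (x : XVec N G E H) (y : YVec G E H)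
    (hv : w + θ • u = -v) :
    P.cost x - ‖w‖ ^ 2 / θ + θ / 4 * ‖gap x y‖ ^ 2 + θ / 2 * ‖gap x y + u‖ ^ 2 ≤
      P.augLag w θ (2 * θ) x y u v := by
  rw [P.augLag_eq x y hv]
  have h1 := real_inner_le_norm w (gap x y)
  have h2 : ‖w‖ * ‖gap x y‖ ≤ ‖w‖ ^ 2 / θ + θ / 4 * ‖gap x y‖ ^ 2 := by
    have h3 : ‖w‖ ^ 2 / θ + θ / 4 * ‖gap x y‖ ^ 2 - ‖w‖ * ‖gap x y‖ =
        (‖w‖ - θ / 2 * ‖gap x y‖) ^ 2 / θ := by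
      field_simp
      ring
    have h4 : 0 ≤ (‖w‖ - θ / 2 * ‖gap x y‖) ^ 2 / θ := by positivity
    linarith
  linarith

end bounds

end Grid

section step

lemma curvature_mul_sum_le {E : Type*} {H : ℕ} {model : TempModel} {C : ℝ≥0} {θ Λ : ℝ}
    {lam : E → Fin H → ℝ} (hlam : ∀ l, ∑ t, lam l t < Λ) (hθ : 0 < θ)
    (hΛ : model = .transient → 2 * (C : ℝ) * Λ ≤ 2 * θ) (l : E) :
    Grid.curvature model C * ∑ t, lam l t ≤ θ := by
  cases model with
  | steady => simpa [Grid.curvature] using hθ.le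
  | transient =>
    have h1 := hΛ rfl
    have h2 := mul_le_mul_of_nonneg_left (hlam l).le C.2
    simp only [Grid.curvature]
    change (C : ℝ) * _ ≤ C * Λ at h2
    linarith

variable {N G E : Type*} [Fintype N] [Fintype G] [Fintype E] {H : ℕ} {P : Grid N G E H}
  {model : TempModel} {C : ℝ≥0} {w : CVec G E H} {θ Λ : ℝ} {a b : Iterate N G E H}

/-- The `u`-update leaves half of the change of `u` as residual. -/
lemma InnerStep.gap_add_eq (hs : InnerStep P model w θ Λ a b) (hθ : 0 < θ)
    (ha : IsStart P model w θ a) :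
    Grid.gap b.x b.y + b.u = (1 / 2 : ℝ) • (a.u - b.u) := by
  have h1 : (2 * θ + θ) • b.u = -a.v - w - (2 * θ) • Grid.gap b.x b.y := by
    rw [hs.u_update, smul_smul, mul_inv_cancel₀ (by positivity), one_smul]
  rw [← ha.2] at h1
  have h2 : θ • (Grid.gap b.x b.y + b.u) = θ • ((1 / 2 : ℝ) • (a.u - b.u)) := by
    linear_combination (norm := module) (1 / 2 : ℝ) • h1
  exact smul_right_injective _ hθ.ne' h2

lemma InnerStep.v_eq (hs : InnerStep P model w θ Λ a b) (hθ : 0 < θ)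
    (ha : IsStart P model w θ a) : b.v = a.v + θ • (a.u - b.u) := by
  rw [hs.v_update, hs.gap_add_eq hθ ha, smul_smul]
  congr 2
  ring

lemma InnerStep.x_mem (hs : InnerStep P model w θ Λ a b) : b.x ∈ P.X := by
  obtain ⟨n, hn, -⟩ := hs.x_stationary
  exact hn.1

/-- The invariant `w + θ u = -v` is preserved. -/
lemma InnerStep.isStart (hs : InnerStep P model w θ Λ a b) (hθ : 0 < θ)
    (ha : IsStart P model w θ a) : IsStart P model w θ b := by
  obtain ⟨lam, hy, -⟩ := hs.y_stationary
  refine ⟨hy.1, ?_⟩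
  rw [hs.v_eq hθ ha, neg_add, ← ha.2, smul_sub]
  abel

/-- Sufficient decrease of the augmented Lagrangian. -/
lemma InnerStep.descent (hs : InnerStep P model w θ Λ a b) (hθ : 0 < θ)
    (ha : IsStart P model w θ a) (hC : P.IsSmoothnessConst C)
    (hΛ : model = .transient → 2 * (C : ℝ) * Λ ≤ 2 * θ) :
    P.augLag w θ (2 * θ) b.x b.y b.u b.v
        + θ / 2 * ‖Grid.act (Grid.matB G E H) a.y - Grid.act (Grid.matB G E H) b.y‖ ^ 2
        + θ * ‖a.u - b.u‖ ^ 2 ≤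
      P.augLag w θ (2 * θ) a.x a.y a.u a.v := by
  refine le_trans ?_ hs.x_descent
  obtain ⟨lam, hy, hlam⟩ := hs.y_stationary
  have hkey := hy.inner_ge hC (curvature_mul_sum_le hlam hθ hΛ) hθ.le ha.1
  have hyy : P.augLag w θ (2 * θ) b.x a.y a.u a.v - P.augLag w θ (2 * θ) b.x b.y a.u a.v =
      ⟪a.v + (2 * θ) • (Grid.gap b.x b.y + a.u),
        Grid.act (Grid.matB G E H) a.y - Grid.act (Grid.matB G E H) b.y⟫ +
      θ * ‖Grid.act (Grid.matB G E H) a.y - Grid.act (Grid.matB G E H) b.y‖ ^ 2 := by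
    have hgap : Grid.gap b.x a.y = Grid.gap b.x b.y +
        (Grid.act (Grid.matB G E H) a.y - Grid.act (Grid.matB G E H) b.y) := by
      simp only [Grid.gap]
      abel
    rw [Grid.augLag, Grid.augLag, hgap]
    generalize Grid.act (Grid.matB G E H) a.y - Grid.act (Grid.matB G E H) b.y = z
    generalize Grid.gap b.x b.y = r
    rw [show r + z + a.u = (r + a.u) + z by abel, norm_add_sq_real]
    simp only [inner_add_left, inner_add_right, real_inner_smul_left]
    ring
  have huv : P.augLag w θ (2 * θ) b.x b.y a.u a.v - P.augLag w θ (2 * θ) b.x b.y b.u b.v =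
      θ * ‖a.u - b.u‖ ^ 2 := by
    have hr := hs.gap_add_eq hθ ha
    have hv := hs.v_eq hθ ha
    have hav : a.v = -(w + θ • a.u) := by rw [ha.2, neg_neg]
    rw [Grid.augLag, Grid.augLag]
    generalize Grid.gap b.x b.y = r at *
    have hr1 : r + a.u = (3 / 2 : ℝ) • (a.u - b.u) := by
      rw [show r + a.u = r + b.u + (a.u - b.u) by abel, hr]
      module
    rw [hr1, hr, hv, hav]
    simp only [← real_inner_self_eq_norm_sq, inner_add_left, inner_sub_left, inner_sub_right,
      inner_neg_left, real_inner_smul_left, real_inner_smul_right, real_inner_comm a.u b.u]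
    ring
  linarith

/-- The new iterate is approximately stationary for the relaxed problem, with residuals bounded
by the changes of `B y` and of `u`. -/
lemma InnerStep.isRelaxedStationary (hs : InnerStep P model w θ Λ a b) (hθ : 0 < θ)
    (ha : IsStart P model w θ a) (hC : P.IsSmoothnessConst C)
    (hΛ : model = .transient → 2 * (C : ℝ) * Λ ≤ 2 * θ) {ε : ℝ}
    (h1 : 2 * θ * (‖Grid.act (Grid.matB G E H) a.y - Grid.act (Grid.matB G E H) b.y‖
      + ‖a.u - b.u‖) ≤ ε) (h2 : ‖a.u - b.u‖ / 2 ≤ ε) :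
    P.IsRelaxedStationary model w θ ε b.x b.y b.u := by
  have hv2 := hs.v_update
  have hθu : 2 * θ * ‖a.u - b.u‖ ≤ ε := by
    refine le_trans ?_ h1
    gcongr
    exact le_add_of_nonneg_left (norm_nonneg _)
  refine ⟨b.v, ?_, ?_, ?_, ?_⟩
  · obtain ⟨n, hn, hn0⟩ := hs.x_stationary
    refine ⟨n, hn, ?_⟩
    have : gradient P.cost b.x + Grid.act (Grid.matA N G E H).transpose b.v + n =
        Grid.act (Grid.matA N G E H).transpose
          (b.v - (a.v + (2 * θ) • (Grid.gap b.x a.y + a.u))) := by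
      rw [Grid.act_sub]
      linear_combination (norm := module) hn0
    rw [this, Grid.norm_act_matA_transpose]
    have hd : b.v - (a.v + (2 * θ) • (Grid.gap b.x a.y + a.u)) = -((2 * θ) •
        ((Grid.act (Grid.matB G E H) a.y - Grid.act (Grid.matB G E H) b.y) + (a.u - b.u))) := by
      rw [hv2]
      simp only [Grid.gap]
      module
    rw [hd, norm_neg, norm_smul, Real.norm_of_nonneg (by positivity)]
    refine le_trans ?_ h1
    gcongr
    exact norm_add_le _ _
  · obtain ⟨lam, hy, hlam⟩ := hs.y_stationary
    refine ⟨_, hy.neg_mem_normalCone hC (curvature_mul_sum_le hlam hθ hΛ) hθ.le, ?_⟩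
    rw [← sub_eq_add_neg, ← Grid.act_sub, Grid.norm_act_matB_transpose]
    have hd : b.v - (a.v + (2 * θ) • (Grid.gap b.x b.y + a.u)) =
        -((2 * θ) • (a.u - b.u)) := by
      rw [hv2]
      module
    rw [hd, norm_neg, norm_smul, Real.norm_of_nonneg (by positivity)]
    exact hθu
  · rw [(hs.isStart hθ ha).2]
    simpa using (by positivity : 0 ≤ ‖a.u - b.u‖ / 2).trans h2
  · rw [hs.gap_add_eq hθ ha, norm_smul]
    refine le_trans (le_of_eq ?_) h2
    norm_num
    ring

/-- An iteration that does not reach the tolerance `η` decreases the augmented Lagrangian by a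
multiple of `η² / θ`. -/
lemma InnerStep.decrease (hs : InnerStep P model w θ Λ a b) {θ0 : ℝ} (hθ0 : 0 < θ0)
    (hθ : θ0 ≤ θ) (ha : IsStart P model w θ a) (hC : P.IsSmoothnessConst C)
    (hΛ : model = .transient → 2 * (C : ℝ) * Λ ≤ 2 * θ) {η : ℝ} (hη : 0 < η)
    (hex : ¬ P.IsRelaxedStationary model w θ η b.x b.y b.u) :
    P.augLag w θ (2 * θ) b.x b.y b.u b.v + min (1 / 16) (4 * θ0 ^ 2) * η ^ 2 / θ ≤
      P.augLag w θ (2 * θ) a.x a.y a.u a.v := by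
  have hθ' : 0 < θ := hθ0.trans_le hθ
  have hd := hs.descent hθ' ha hC hΛ
  set z := ‖Grid.act (Grid.matB G E H) a.y - Grid.act (Grid.matB G E H) b.y‖
  set p := ‖a.u - b.u‖
  have hz : 0 ≤ z := norm_nonneg _
  have hp : 0 ≤ p := norm_nonneg _
  have key : min (1 / 16) (4 * θ0 ^ 2) * η ^ 2 / θ ≤ θ / 2 * z ^ 2 + θ * p ^ 2 := by
    rw [div_le_iff₀ hθ']
    -- Since the tolerance is missed, `2 θ (z + p) > η` or `p / 2 > η`.
    rcases lt_or_ge η (2 * θ * (z + p)) with h | h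
    · have h1 : η ^ 2 ≤ (2 * θ * (z + p)) ^ 2 := by gcongr
      have h2 : min (1 / 16) (4 * θ0 ^ 2) * η ^ 2 ≤ 1 / 16 * η ^ 2 := by
        gcongr
        exact min_le_left _ _
      have h3 : 0 ≤ θ ^ 2 * (z - p) ^ 2 := by positivity
      have h4 : 0 ≤ θ ^ 2 * p ^ 2 := by positivity
      nlinarith
    · have h' : 2 * η < p := by
        by_contra! h'
        exact hex (hs.isRelaxedStationary hθ' ha hC hΛ h (by linarith))
      have h1 : (2 * η) ^ 2 ≤ p ^ 2 := by gcongr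
      have h2 : min (1 / 16) (4 * θ0 ^ 2) * η ^ 2 ≤ 4 * θ0 ^ 2 * η ^ 2 := by
        gcongr
        exact min_le_right _ _
      have h3 : θ0 ^ 2 * (2 * η) ^ 2 ≤ θ ^ 2 * p ^ 2 := by gcongr
      have h4 : 0 ≤ θ ^ 2 * z ^ 2 := by positivity
      nlinarith
  linarith

/-- An iteration never increases the augmented Lagrangian. -/
lemma InnerStep.augLag_le (hs : InnerStep P model w θ Λ a b) (hθ : 0 < θ)
    (ha : IsStart P model w θ a) (hC : P.IsSmoothnessConst C)
    (hΛ : model = .transient → 2 * (C : ℝ) * Λ ≤ 2 * θ) :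
    P.augLag w θ (2 * θ) b.x b.y b.u b.v ≤ P.augLag w θ (2 * θ) a.x a.y a.u a.v := by
  refine le_trans ?_ (hs.descent hθ ha hC hΛ)
  rw [add_assoc]
  exact le_add_of_nonneg_right (by positivity)

end step

/-! ### Counting the iterations of all inner loops -/

/-- The counting argument behind the total complexity. Here `θ` is the penalty, `L` the augmented
Lagrangian before an iteration, `s` the size of the slack after it and `r` the size of the
reference slack; `ex` marks the ends of the inner loops. A loop with penalty `θ` takes about
`E θ / D` iterations. Writing `θ = √θ √θ ≤ c √θ / s`, the loops with the same penalty cost at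
most a geometric series in `1 / s` times `√θ`, and these costs form a geometric series in `√θ`,
so that no logarithmic factor arises. The potential is
`E c (c₁ β + c₂ / b) √θ + (Lh - L) θ`, with `β` the inverse of the reference slack. -/
lemma iterations_le {θ L s r : ℕ → ℝ} {ex : ℕ → Prop} {M : ℕ}
    {γ ω θ0 Θ D E Lh low c b : ℝ} (hγ : 1 < γ) (hω0 : 0 ≤ ω) (hω : ω < 1) (hθ0 : 0 < θ0)
    (hD : 0 < D) (hE : Lh - low + D / θ0 ≤ E) (hb : 0 < b) (hc : 0 ≤ c)
    (hΘ0 : θ0 ≤ Θ) (hΘ : γ * (c / b) ^ 2 ≤ Θ)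
    (hinit : θ 0 = θ0) (hL0 : L 0 ≤ Lh) (hθ : ∀ n ≤ M, θ0 ≤ θ n) (hlow : ∀ n ≤ M, low ≤ L n)
    (hin : ∀ n < M, ¬ ex n → L (n + 1) + D / θ n ≤ L n ∧ θ (n + 1) = θ n ∧ r (n + 1) = r n)
    (hout : ∀ n < M, ex n → L (n + 1) ≤ Lh ∧ r (n + 1) = s n ∧ b ≤ s n ∧ √(θ n) * s n ≤ c ∧
      (θ (n + 1) = γ * θ n ∨ θ (n + 1) = θ n ∧ s n ≤ ω * r n)) :
    M * D ≤ E * (c * (1 / (1 - ω) + (1 / (1 - ω) + 1) / (√γ - 1)) / b * √Θ + Θ) := by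
  -- `c₁` sums the series of the loops with equal penalty, `c₂` the series over the penalties.
  set c₁ : ℝ := 1 / (1 - ω) with hc₁
  set c₂ : ℝ := (c₁ + 1) / (√γ - 1) with hc₂
  have hω1 : 0 < 1 - ω := sub_pos.2 hω
  have hc₁0 : 0 < c₁ := by positivity
  have hc₁e : c₁ * ω + 1 = c₁ := by rw [hc₁]; field_simp; ring
  have hγ1 : 0 < √γ - 1 := sub_pos.2 (Real.lt_sqrt_of_sq_lt (by simpa using hγ))
  have hc₂0 : 0 < c₂ := by positivity
  have hc₂e : c₂ * √γ = c₂ + (c₁ + 1) := by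
    have : c₂ * (√γ - 1) = c₁ + 1 := div_mul_cancel₀ _ hγ1.ne'
    linarith
  have hE0 : 0 ≤ E := by
    have := (hlow 0 (Nat.zero_le _)).trans hL0
    have : 0 < D / θ0 := by positivity
    linarith
  -- `β` stands for `1 / r n`; it is `0` during the first loop, whose reference slack is arbitrary.
  have hinv : ∀ n ≤ M, θ n ≤ Θ ∧ ∃ β, 0 ≤ β ∧ β ≤ 1 / b ∧ β * r n ≤ 1 ∧
      n * D ≤ E * c * ((c₁ * β + c₂ * (1 / b)) * √(θ n)) + (Lh - L n) * θ n := by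
    intro n
    induction n with
    | zero =>
      intro _
      refine ⟨hinit ▸ hΘ0, 0, le_rfl, by positivity, by simp, ?_⟩
      have h1 : 0 ≤ (Lh - L 0) * θ 0 := mul_nonneg (sub_nonneg.2 hL0) (hinit ▸ hθ0.le)
      have h2 : 0 ≤ E * c * ((c₁ * 0 + c₂ * (1 / b)) * √(θ 0)) := by positivity
      simp only [Nat.cast_zero, zero_mul]
      linarith
    | succ n ih =>
      intro hn
      have hnM : n < M := hn
      obtain ⟨hle, β, hβ0, hβb, hβr, hpot⟩ := ih hnM.le
      have hθn : 0 < θ n := hθ0.trans_le (hθ n hnM.le)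
      push_cast
      by_cases hex : ex n
      · obtain ⟨hL, hr, hbs, hsc, hcase⟩ := hout n hnM hex
        have hs : 0 < s n := hb.trans_le hbs
        have hsq : √(θ n) * √(θ n) = θ n := Real.mul_self_sqrt hθn.le
        have hsqrt : √(θ n) ≤ c * (1 / s n) := by
          rw [mul_one_div, le_div_iff₀ hs]
          exact hsc
        have hsb : 1 / s n ≤ 1 / b := one_div_le_one_div_of_le hb hbs
        have hloop : (Lh - L n) * θ n + D ≤ E * c * (1 / s n * √(θ n)) := by
          have h1 : D ≤ D / θ0 * θ n := by
            rw [div_mul_eq_mul_div, le_div_iff₀ hθ0]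
            exact mul_le_mul_of_nonneg_left (hθ n hnM.le) hD.le
          have h2 : (Lh - L n + D / θ0) * θ n ≤ E * θ n := by
            refine mul_le_mul_of_nonneg_right ?_ hθn.le
            have := hlow n hnM.le
            linarith
          have h3 : E * (√(θ n) * √(θ n)) ≤ E * (c * (1 / s n) * √(θ n)) := by gcongr
          rw [hsq] at h3
          linarith
        have hLθ : 0 ≤ (Lh - L (n + 1)) * θ (n + 1) :=
          mul_nonneg (sub_nonneg.2 hL) (hθ0.le.trans (hθ (n + 1) hn))
        refine ⟨?_, 1 / s n, by positivity, hsb, ?_, ?_⟩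
        · rcases hcase with h | ⟨h, -⟩
          · rw [h]
            refine le_trans ?_ hΘ
            gcongr
            rw [← hsq, ← sq]
            gcongr
            refine hsqrt.trans ?_
            rw [mul_one_div]
            gcongr
          · rwa [h]
        · rw [hr, one_div_mul_cancel hs.ne']
        · suffices H : (c₁ * β + c₂ * (1 / b)) * √(θ n) + 1 / s n * √(θ n) ≤
              (c₁ * (1 / s n) + c₂ * (1 / b)) * √(θ (n + 1)) by
            have := mul_le_mul_of_nonneg_left H (mul_nonneg hE0 hc)
            linarith
          rw [← add_mul]
          rcases hcase with h | ⟨h, hs'⟩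
          -- The penalty grows: the costs `c₁ β` and `1 / s n` are paid by the growth of `√θ`.
          · rw [h, Real.sqrt_mul (by positivity), ← mul_assoc]
            refine mul_le_mul_of_nonneg_right ?_ (Real.sqrt_nonneg _)
            have h1 : c₁ * β ≤ c₁ * (1 / b) := by gcongr
            have h2 : 0 ≤ c₁ * (1 / s n) * √γ := by positivity
            have h3 : c₂ * (1 / b) * √γ = (c₂ + (c₁ + 1)) * (1 / b) := by
              rw [← hc₂e]
              ring
            linarith
          -- The penalty is kept: `β` is at most `ω / s n`, and `c₁ ω + 1 = c₁`.
          · rw [h]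
            refine mul_le_mul_of_nonneg_right ?_ (Real.sqrt_nonneg _)
            have h1 : β ≤ ω * (1 / s n) := by
              rw [mul_one_div, le_div_iff₀ hs]
              have h2 := mul_le_mul_of_nonneg_left hs' hβ0
              have h3 := mul_le_mul_of_nonneg_left hβr hω0
              linarith
            have h2 : c₁ * β ≤ c₁ * (ω * (1 / s n)) := by gcongr
            have h3 : c₁ * (1 / s n) = c₁ * (ω * (1 / s n)) + 1 / s n := by
              rw [← mul_assoc, ← add_one_mul, hc₁e]
            linarith
      · obtain ⟨hL, hθe, hr⟩ := hin n hnM hex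
        refine ⟨hθe ▸ hle, β, hβ0, hβb, hr ▸ hβr, ?_⟩
        rw [hθe]
        have h1 := mul_le_mul_of_nonneg_right hL hθn.le
        rw [add_mul, div_mul_cancel₀ _ hθn.ne'] at h1
        linarith
  obtain ⟨hle, β, hβ0, hβb, -, hpot⟩ := hinv M le_rfl
  have hθM : 0 < θ M := hθ0.trans_le (hθ M le_rfl)
  have h1 : (Lh - L M) * θ M ≤ E * Θ := by
    have hD0 : 0 < D / θ0 := by positivity
    have := hlow M le_rfl
    exact mul_le_mul (by linarith) hle hθM.le hE0
  have h2 : E * c * ((c₁ * β + c₂ * (1 / b)) * √(θ M)) ≤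
      E * c * ((c₁ * (1 / b) + c₂ * (1 / b)) * √Θ) := by gcongr
  calc M * D ≤ E * c * ((c₁ * (1 / b) + c₂ * (1 / b)) * √Θ) + E * Θ := by linarith
    _ = E * (c * (c₁ + c₂) / b * √Θ + Θ) := by ring

/-! ### Runs of the bi-level algorithm -/

section projection

variable {G E : Type*} [Fintype G] [Fintype E] {H : ℕ}

lemma norm_projBox_le (lo hi w : CVec G E H) :
    ‖projBox lo hi w‖ ≤ ‖(WithLp.toLp 2 fun i => |lo i| + |hi i| : CVec G E H)‖ := by
  simp only [EuclideanSpace.norm_eq]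
  refine Real.sqrt_le_sqrt (Finset.sum_le_sum fun i _ => ?_)
  gcongr
  rw [Real.norm_eq_abs, Real.norm_of_nonneg (by positivity)]
  refine abs_le.2 ⟨?_, ?_⟩
  · have := (neg_abs_le (lo i)).trans (le_max_left (lo i) (min (hi i) (w i)))
    have := abs_nonneg (hi i)
    simp only [projBox]
    linarith
  · simp only [projBox]
    refine max_le ((le_abs_self _).trans (le_add_of_nonneg_right (abs_nonneg _))) ?_
    exact (min_le_left _ _).trans ((le_abs_self _).trans (le_add_of_nonneg_left (abs_nonneg _)))

end projection

namespace Params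

variable {G E : Type*} [Fintype G] [Fintype E] {H : ℕ}

/-- A bound on the outer dual variables of all runs. -/
def dualBound (par : Params G E H) : ℝ :=
  ‖par.w0‖ + ‖(WithLp.toLp 2 fun i => |par.wlo i| + |par.whi i| : CVec G E H)‖

lemma dualBound_nonneg (par : Params G E H) : 0 ≤ par.dualBound := by
  unfold dualBound
  positivity

end Params

namespace Trace

section runs

variable {N G E : Type*} [Fintype N] [Fintype G] [Fintype E] {H : ℕ} {P : Grid N G E H}
  {model : TempModel} {par : Params G E H} {ε : ℝ} {tr : Trace N G E H} {C : ℝ≥0}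

lemma Running.of_succ {n : ℕ} (h : tr.Running P model par ε (n + 1)) :
    tr.Running P model par ε n := fun m hm => h m (hm.trans (Nat.lt_succ_self n))

lemma Running.mono {m n : ℕ} (h : tr.Running P model par ε n) (hmn : m ≤ n) :
    tr.Running P model par ε m := fun k hk => h k (hk.trans_le hmn)

lemma θ_succ_le (hrun : tr.IsRun P model par ε) {n : ℕ} (hθ : 0 ≤ tr.θ n)
    (h : tr.Running P model par ε (n + 1)) (hex : tr.InnerExit P model par ε n) :
    tr.θ n ≤ tr.θ (n + 1) ∧ tr.θ (n + 1) ≤ par.γ * tr.θ n := by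
  have h1 : tr.θ n ≤ par.γ * tr.θ n := le_mul_of_one_le_left hθ par.one_lt_γ.le
  rw [(hrun.outer_update n h hex).2.1]
  split_ifs
  · exact ⟨h1, le_rfl⟩
  · exact ⟨le_rfl, h1⟩

/-- Invariants of a run: every iteration starts with `y` feasible and `w + θ u = -v`. -/
lemma IsRun.invariant (hrun : tr.IsRun P model par ε) {n : ℕ}
    (h : tr.Running P model par ε n) :
    IsStart P model (tr.w n) (tr.θ n) (tr.pre n) ∧ par.θ0 ≤ tr.θ n ∧
      ‖tr.w n‖ ≤ par.dualBound := by
  induction n with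
  | zero =>
    refine ⟨hrun.init_start, hrun.init_θ.ge, ?_⟩
    rw [hrun.init_w]
    exact le_add_of_nonneg_right (norm_nonneg _)
  | succ n ih =>
    obtain ⟨hs, hθ, hw⟩ := ih h.of_succ
    have hθ' : 0 < tr.θ n := par.θ0_pos.trans_le hθ
    by_cases hex : tr.InnerExit P model par ε n
    · obtain ⟨h1, -, -, h4⟩ := hrun.outer_update n h hex
      refine ⟨h4, hθ.trans (θ_succ_le hrun hθ'.le h hex).1, ?_⟩
      rw [h1]
      exact (norm_projBox_le _ _ _).trans (le_add_of_nonneg_left (norm_nonneg _))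
    · obtain ⟨h1, h2, h3, -⟩ := hrun.continue_inner n h hex
      rw [h1, h2, h3]
      exact ⟨(hrun.step n h.of_succ).isStart hθ' hs, hθ, hw⟩

/-- The augmented Lagrangian after iteration `n`. -/
def postLag (tr : Trace N G E H) (P : Grid N G E H) (n : ℕ) : ℝ :=
  P.augLag (tr.w n) (tr.θ n) (2 * tr.θ n)
    (tr.post n).x (tr.post n).y (tr.post n).u (tr.post n).v

lemma IsRun.postLag_le (hrun : tr.IsRun P model par ε) (hC : P.IsSmoothnessConst C)
    (hpen : tr.PenaltyCondition P model par ε C) {n : ℕ} (h : tr.Running P model par ε n) :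
    tr.postLag P n ≤ tr.preLag P n := by
  obtain ⟨hs, hθ, -⟩ := hrun.invariant h
  exact (hrun.step n h).augLag_le (par.θ0_pos.trans_le hθ) hs hC fun hm => hpen hm n h

lemma IsRun.preLag_succ (hrun : tr.IsRun P model par ε) {n : ℕ}
    (h : tr.Running P model par ε (n + 1)) (hex : ¬ tr.InnerExit P model par ε n) :
    tr.preLag P (n + 1) = tr.postLag P n := by
  obtain ⟨h1, h2, h3, -⟩ := hrun.continue_inner n h hex
  rw [preLag, postLag, h1, h2, h3]

lemma IsRun.preLag_le (hrun : tr.IsRun P model par ε) (hC : P.IsSmoothnessConst C)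
    (hpen : tr.PenaltyCondition P model par ε C) {L : ℝ}
    (hst : tr.StartsBounded P model par ε L) {n : ℕ} (h : tr.Running P model par ε n) :
    tr.preLag P n ≤ L := by
  induction n with
  | zero => exact hst.1
  | succ n ih =>
    by_cases hex : tr.InnerExit P model par ε n
    · exact hst.2 n h hex
    · rw [hrun.preLag_succ h hex]
      exact (hrun.postLag_le hC hpen h.of_succ).trans (ih h.of_succ)

/-- The residuals after an iteration are controlled by the augmented Lagrangian. -/
lemma IsRun.residuals_le (hrun : tr.IsRun P model par ε) {cb : ℝ}
    (hcb : ∀ x ∈ P.X, |P.cost x| ≤ cb) {n : ℕ} (h : tr.Running P model par ε n) :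
    tr.θ n / 4 * ‖Grid.gap (tr.post n).x (tr.post n).y‖ ^ 2 +
      tr.θ n / 2 * ‖Grid.gap (tr.post n).x (tr.post n).y + (tr.post n).u‖ ^ 2 ≤
    tr.postLag P n + cb + par.dualBound ^ 2 / par.θ0 := by
  obtain ⟨hs, hθ, hw⟩ := hrun.invariant h
  have hθ' := par.θ0_pos.trans_le hθ
  have hstep := hrun.step n h
  have h1 := P.augLag_ge hθ' (tr.post n).x (tr.post n).y (hstep.isStart hθ' hs).2
  have h2 := neg_le_of_abs_le (hcb _ hstep.x_mem)
  have h3 : ‖tr.w n‖ ^ 2 / tr.θ n ≤ par.dualBound ^ 2 / par.θ0 := by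
    have := par.θ0_pos
    gcongr
  rw [postLag]
  linarith

/-- At the end of an inner loop that is not the last one, the slack exceeds `(1 - κ) ε`. -/
lemma lt_norm_slack {n : ℕ} (h : tr.Running P model par ε (n + 1))
    (hex : tr.InnerExit P model par ε n) :
    (1 - par.κ) * ε < ‖(tr.post n).u‖ := by
  have hgap : ε < ‖Grid.gap (tr.post n).x (tr.post n).y‖ := by
    by_contra! hle
    exact h n (Nat.lt_succ_self n) ⟨hex, hle⟩
  obtain ⟨v, -, -, -, h4⟩ := hex
  have := norm_sub_le (Grid.gap (tr.post n).x (tr.post n).y + (tr.post n).u) (tr.post n).u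
  rw [add_sub_cancel_right] at this
  linarith

/-- The final point of a terminating run is `ε`-stationary for the consensus problem. -/
lemma Terminates.isStationary {n : ℕ} (hε : 0 < ε) (h : tr.Terminates P model par ε n) :
    P.IsStationary model ε (tr.post n).x (tr.post n).y := by
  obtain ⟨⟨v, ⟨n₁, hn₁, h₁⟩, ⟨n₂, hn₂, h₂⟩, -, -⟩, hgap⟩ := h
  have hle : par.κ * ε ≤ ε := mul_le_of_le_one_left hε.le par.κ_lt_one.le
  exact ⟨v, ⟨n₁, hn₁, h₁.trans hle⟩, ⟨n₂, hn₂, h₂.trans hle⟩, hgap⟩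

end runs

end Trace

/-- Complexity of the bi-level algorithm when the augmented Lagrangian is bounded at the beginning
of every inner loop and the slacks at their ends satisfy `θ ‖u‖ ^ k ≤ c`. Since those slacks exceed
a multiple of `ε`, the penalties are `O(1 / ε ^ k)`, and an inner loop with penalty `θ` takes
`O(θ / ε ^ 2)` iterations. -/
theorem exists_rate {N G E : Type*} [Fintype N] [Fintype G] [Fintype E] {H : ℕ}
    (P : Grid N G E H) (model : TempModel) {C : ℝ≥0} (hC : P.IsSmoothnessConst C)
    (par : Params G E H) {k : ℕ} (hk : k ≠ 0) (c L : ℝ) :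
    ∃ K : ℝ, ∀ ε : ℝ, 0 < ε → ε ≤ 1 → ∀ tr : Trace N G E H,
      tr.IsRun P model par ε → tr.PenaltyCondition P model par ε C →
      tr.StartsBounded P model par ε L →
      (∀ n, tr.Running P model par ε (n + 1) → tr.InnerExit P model par ε n →
        tr.θ n * ‖(tr.post n).u‖ ^ k ≤ c) →
      tr.ReachesWithin P model par ε (K / ε ^ (2 + k)) := by
  obtain ⟨cb, hcb0, hcb⟩ := P.exists_abs_cost_le
  have hθ0 := par.θ0_pos
  have hγ := par.one_lt_γ
  have hκ : 0 < 1 - par.κ := sub_pos.2 par.κ_lt_one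
  have hκ0 := par.κ_pos
  set δ : ℝ := min (1 / 16) (4 * par.θ0 ^ 2) * par.κ ^ 2 with hδdef
  have hδ : 0 < δ := by positivity
  set low : ℝ := -(cb + par.dualBound ^ 2 / par.θ0)
  set ω : ℝ := √(par.ω ^ k)
  have hω : ω < 1 := by
    rw [← Real.sqrt_one]
    exact Real.sqrt_lt_sqrt (pow_nonneg par.ω_pos.le k)
      (pow_lt_one₀ par.ω_pos.le par.ω_lt_one hk)
  set B : ℝ := √((1 - par.κ) ^ k)
  have hB : 0 < B := Real.sqrt_pos.2 (by positivity)
  set Θ : ℝ := par.θ0 + par.γ * (√c / B) ^ 2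
  have hΘ : 0 < Θ := by positivity
  set E₀ : ℝ := L - low + δ / par.θ0
  set K₀ : ℝ := E₀ * (√c * (1 / (1 - ω) + (1 / (1 - ω) + 1) / (√par.γ - 1)) / B * √Θ + Θ) / δ
  refine ⟨K₀ + 1, fun ε hε hε1 tr hrun hpen hst hslack => ?_⟩
  have hbound : ∀ M, tr.Running P model par ε M → (M : ℝ) ≤ K₀ / ε ^ (2 + k) := by
    intro M hM
    have hεk : 0 < √(ε ^ k) := Real.sqrt_pos.2 (by positivity)
    have hεk2 : √(ε ^ k) ^ 2 = ε ^ k := Real.sq_sqrt (by positivity)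
    have hlow : ∀ n ≤ M, low ≤ tr.preLag P n := by
      intro n hn
      have h := hM.mono hn
      refine le_trans ?_ (hrun.postLag_le hC hpen h)
      have h1 := hrun.residuals_le hcb h
      have hθn := hθ0.trans_le (hrun.invariant h).2.1
      have h2 : 0 ≤ tr.θ n / 4 * ‖Grid.gap (tr.post n).x (tr.post n).y‖ ^ 2 +
        tr.θ n / 2 * ‖Grid.gap (tr.post n).x (tr.post n).y + (tr.post n).u‖ ^ 2 := by positivity
      simp only [low]
      linarith
    have key := iterations_le (θ := tr.θ) (L := tr.preLag P)
      (s := fun n => √(‖(tr.post n).u‖ ^ k)) (r := fun n => √(‖tr.uLast n‖ ^ k))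
      (ex := tr.InnerExit P model par ε) (M := M) (γ := par.γ) (ω := ω) (θ0 := par.θ0)
      (Θ := Θ / ε ^ k) (D := δ * ε ^ 2) (E := E₀) (Lh := L) (low := low) (c := √c)
      (b := B * √(ε ^ k)) hγ (Real.sqrt_nonneg _) hω hθ0 (by positivity) ?_ (by positivity)
      (Real.sqrt_nonneg _) ?_ ?_ hrun.init_θ hst.1
      (fun n hn => (hrun.invariant (hM.mono hn)).2.1) hlow ?_ ?_
    · rw [Real.sqrt_div hΘ.le] at key
      have he : E₀ * (√c * (1 / (1 - ω) + (1 / (1 - ω) + 1) / (√par.γ - 1)) / (B * √(ε ^ k)) *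
          (√Θ / √(ε ^ k)) + Θ / ε ^ k) = K₀ * δ / ε ^ k := by
        have hK : K₀ * δ = E₀ * (√c * (1 / (1 - ω) + (1 / (1 - ω) + 1) / (√par.γ - 1)) / B *
            √Θ + Θ) := div_mul_cancel₀ _ hδ.ne'
        rw [hK]
        generalize √c * (1 / (1 - ω) + (1 / (1 - ω) + 1) / (√par.γ - 1)) = q
        clear key
        generalize √(ε ^ k) = e at hεk hεk2 ⊢
        rw [← hεk2]
        field_simp
      rw [he, le_div_iff₀ (by positivity)] at key
      rw [le_div_iff₀ (by positivity), pow_add]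
      refine le_of_mul_le_mul_right ?_ hδ
      linarith
    · simp only [E₀]
      have : δ * ε ^ 2 / par.θ0 ≤ δ / par.θ0 := by
        gcongr
        exact mul_le_of_le_one_right hδ.le (pow_le_one₀ hε.le hε1)
      linarith
    · rw [le_div_iff₀ (by positivity)]
      refine (mul_le_of_le_one_right hθ0.le (pow_le_one₀ hε.le hε1)).trans ?_
      exact le_add_of_nonneg_right (by positivity)
    · rw [← div_div, div_pow, hεk2, ← mul_div_assoc]
      gcongr
      exact le_add_of_nonneg_left hθ0.le
    · intro n hn hex
      have h := hM.mono (Nat.succ_le_of_lt hn)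
      obtain ⟨hs, hθn, -⟩ := hrun.invariant h.of_succ
      refine ⟨?_, (hrun.continue_inner n h hex).2.2.1, ?_⟩
      · rw [hrun.preLag_succ h hex]
        have := (hrun.step n h.of_succ).decrease hθ0 hθn hs hC (fun hm => hpen hm n h.of_succ)
          (mul_pos hκ0 hε) hex
        rw [mul_pow, ← mul_assoc] at this
        exact this
      · simp only [(hrun.continue_inner n h hex).2.2.2]
    · intro n hn hex
      have h := hM.mono (Nat.succ_le_of_lt hn)
      obtain ⟨-, hθu, hu, -⟩ := hrun.outer_update n h hex
      have hθn := hθ0.trans_le (hrun.invariant h.of_succ).2.1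
      refine ⟨hst.2 n h hex, by simp only [hu], ?_, ?_, ?_⟩
      · rw [← Real.sqrt_mul (by positivity), ← mul_pow]
        refine Real.sqrt_le_sqrt ?_
        have := (Trace.lt_norm_slack h hex).le
        gcongr
      · rw [← Real.sqrt_mul hθn.le]
        exact Real.sqrt_le_sqrt (hslack n h hex)
      · rw [hθu]
        split_ifs with hif
        · exact .inl rfl
        · refine .inr ⟨rfl, ?_⟩
          rw [← Real.sqrt_mul (pow_nonneg par.ω_pos.le k), ← mul_pow]
          refine Real.sqrt_le_sqrt ?_
          have := (not_le.1 hif).le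
          gcongr
  have hterm : ∃ n, tr.Terminates P model par ε n := by
    by_contra! hno
    obtain ⟨M, hM⟩ := exists_nat_gt (K₀ / ε ^ (2 + k))
    exact (hbound M fun m _ => hno m).not_gt hM
  classical
  have hfind := Nat.find_spec hterm
  have hrunning : tr.Running P model par ε (Nat.find hterm) := fun m hm => Nat.find_min hterm hm
  refine ⟨Nat.find hterm, ?_, hrunning, hfind, hfind.isStationary hε⟩
  rw [add_div]
  refine add_le_add (hbound _ hrunning) ?_
  rw [le_div_iff₀ (by positivity), one_mul]
  exact pow_le_one₀ hε.le hε1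

/-! ### The two complexity bounds -/

section complexity

variable {N G E : Type*} [Fintype N] [Fintype G] [Fintype E] {H : ℕ} (P : Grid N G E H)
  (model : TempModel) {C : ℝ≥0} (par : Params G E H)

/-- Bounded augmented Lagrangians at the starts give `θ ‖u‖ ^ 2 = O(1)`, hence the rate
`1 / ε ^ 4`. -/
theorem exists_rate_of_startsBounded (hC : P.IsSmoothnessConst C) (L : ℝ) :
    ∃ K : ℝ, ∀ ε : ℝ, 0 < ε → ε ≤ 1 → ∀ tr : Trace N G E H,
      tr.IsRun P model par ε → tr.PenaltyCondition P model par ε C →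
      tr.StartsBounded P model par ε L → tr.ReachesWithin P model par ε (K / ε ^ 4) := by
  obtain ⟨cb, -, hcb⟩ := P.exists_abs_cost_le
  obtain ⟨K, hK⟩ := exists_rate P model hC par two_ne_zero
    (8 * (L + cb + par.dualBound ^ 2 / par.θ0)) L
  refine ⟨K, fun ε hε hε1 tr hrun hpen hst => hK ε hε hε1 tr hrun hpen hst fun n h _ => ?_⟩
  have h1 := hrun.residuals_le hcb h.of_succ
  have h2 := (hrun.postLag_le hC hpen h.of_succ).trans (hrun.preLag_le hC hpen hst h.of_succ)
  have hθ := par.θ0_pos.trans_le (hrun.invariant h.of_succ).2.1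
  set r := Grid.gap (tr.post n).x (tr.post n).y
  have h3 : ‖(tr.post n).u‖ ^ 2 ≤ 2 * (‖r + (tr.post n).u‖ ^ 2 + ‖r‖ ^ 2) := by
    have h4 := norm_sub_le (r + (tr.post n).u) r
    rw [add_sub_cancel_left] at h4
    have h5 : ‖(tr.post n).u‖ ^ 2 ≤ (‖r + (tr.post n).u‖ + ‖r‖) ^ 2 := by gcongr
    have h6 := sq_nonneg (‖r + (tr.post n).u‖ - ‖r‖)
    linarith
  have h4 := mul_le_mul_of_nonneg_left h3 hθ.le
  have h5 : 0 ≤ tr.θ n * ‖r + (tr.post n).u‖ ^ 2 := by positivity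
  linarith

variable {P model par}

/-- At the end of an inner loop `θ u` is the difference of the unprojected and the projected outer
dual variables. -/
lemma Trace.IsRun.θ_mul_norm_slack_le {ε W : ℝ} {tr : Trace N G E H}
    (hrun : tr.IsRun P model par ε) (hW : tr.DualsBounded P model par ε W) {n : ℕ}
    (h : tr.Running P model par ε n) (hex : tr.InnerExit P model par ε n) :
    tr.θ n * ‖(tr.post n).u‖ ≤ W + par.dualBound := by
  obtain ⟨-, hθ, hw⟩ := hrun.invariant h
  have h1 := norm_sub_le (tr.wHat n) (tr.w n)
  rw [Trace.wHat, add_sub_cancel_left, norm_smul,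
    Real.norm_of_nonneg (par.θ0_pos.le.trans hθ)] at h1
  have h2 := hW n h hex
  rw [Trace.wHat] at h2
  linarith

/-- With bounded outer duals a warm start has a bounded augmented Lagrangian: there `u` is
`O(1 / θ)`, the residual of the previous loop is at most `κ ε`, and `θ ε = O(1)`. -/
lemma exists_startsBounded_of_warm (P : Grid N G E H) (model : TempModel) (par : Params G E H)
    (L W : ℝ) : ∃ L' : ℝ, ∀ ε : ℝ, 0 < ε → ε ≤ 1 → ∀ tr : Trace N G E H,
      tr.IsRun P model par ε → tr.StartsBoundedOrWarm P model par ε L →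
      tr.DualsBounded P model par ε W → tr.StartsBounded P model par ε L' := by
  obtain ⟨cb, -, hcb⟩ := P.exists_abs_cost_le
  set c := W + par.dualBound
  have hκ : 0 < 1 - par.κ := sub_pos.2 par.κ_lt_one
  have hγ : 0 < par.γ := zero_lt_one.trans par.one_lt_γ
  set L₁ : ℝ := cb + par.dualBound * (c / par.θ0 + 1) +
    par.γ * (c ^ 2 / par.θ0 + c / (1 - par.κ)) + par.γ / 2 * (c / (1 - par.κ))
  refine ⟨max L L₁, fun ε hε hε1 tr hrun hst hW => ⟨hst.1.trans (le_max_left _ _), ?_⟩⟩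
  intro n h hex
  rcases hst.2 n h hex with hle | ⟨hx, hy, hu⟩
  · exact hle.trans (le_max_left _ _)
  refine le_trans ?_ (le_max_right _ _)
  obtain ⟨hs', hθ', hw'⟩ := hrun.invariant h
  obtain ⟨-, hθ, -⟩ := hrun.invariant h.of_succ
  have hθ0 := par.θ0_pos
  have hθp : 0 < tr.θ n := hθ0.trans_le hθ
  have hθp' : 0 < tr.θ (n + 1) := hθ0.trans_le hθ'
  have hθγ := (Trace.θ_succ_le hrun hθp.le h hex).2
  have hcost := (abs_le.1 (hcb _ (hrun.step n h.of_succ).x_mem)).2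
  have hslack := Trace.lt_norm_slack h hex
  have hθu := hrun.θ_mul_norm_slack_le hW h.of_succ hex
  have hres : ‖Grid.gap (tr.post n).x (tr.post n).y + (tr.post n).u‖ ≤ ε := by
    obtain ⟨v, -, -, -, h4⟩ := hex
    exact h4.trans (mul_le_of_le_one_left hε.le par.κ_lt_one.le)
  rw [Trace.preLag, P.augLag_eq _ _ hs'.2, hx, hy, hu]
  set r := Grid.gap (tr.post n).x (tr.post n).y
  set q := ‖(tr.post n).u‖
  have hq : 0 ≤ q := norm_nonneg _
  have hr : ‖r‖ ≤ q + ε := by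
    have := norm_sub_le (r + (tr.post n).u) (tr.post n).u
    rw [add_sub_cancel_right] at this
    linarith
  have hc : 0 ≤ c := (mul_nonneg hθp.le hq).trans hθu
  have hqθ : q ≤ c / par.θ0 := by
    rw [le_div_iff₀ hθ0, mul_comm]
    exact (mul_le_mul_of_nonneg_right hθ hq).trans hθu
  have hθε : tr.θ n * ε ≤ c / (1 - par.κ) := by
    rw [le_div_iff₀ hκ]
    have := mul_le_mul_of_nonneg_left hslack.le hθp.le
    linarith
  have hθε2 : tr.θ n * ε ^ 2 ≤ c / (1 - par.κ) := by
    refine le_trans ?_ hθε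
    rw [sq, ← mul_assoc]
    exact mul_le_of_le_one_right (by positivity) hε1
  have hθq2 : tr.θ n * q ^ 2 ≤ c ^ 2 / par.θ0 := by
    calc tr.θ n * q ^ 2 = tr.θ n * q * q := by ring
      _ ≤ c * (c / par.θ0) := by gcongr
      _ = c ^ 2 / par.θ0 := by ring
  have hlin : -⟪tr.w (n + 1), r⟫ ≤ par.dualBound * (c / par.θ0 + 1) := by
    refine (neg_le_abs _).trans ((abs_real_inner_le_norm _ _).trans ?_)
    have := par.dualBound_nonneg
    gcongr
    linarith
  have hr2 : ‖r‖ ^ 2 ≤ 2 * (q ^ 2 + ε ^ 2) := by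
    have h1 : ‖r‖ ^ 2 ≤ (q + ε) ^ 2 := by gcongr
    have := sq_nonneg (q - ε)
    linarith
  have h1 : tr.θ (n + 1) / 2 * ‖r‖ ^ 2 ≤
      par.γ * (c ^ 2 / par.θ0 + c / (1 - par.κ)) := by
    calc tr.θ (n + 1) / 2 * ‖r‖ ^ 2 ≤ par.γ * tr.θ n / 2 * (2 * (q ^ 2 + ε ^ 2)) := by gcongr
      _ = par.γ * (tr.θ n * q ^ 2 + tr.θ n * ε ^ 2) := by ring
      _ ≤ _ := by gcongr
  have h2 : tr.θ (n + 1) / 2 * ‖r + (tr.post n).u‖ ^ 2 ≤ par.γ / 2 * (c / (1 - par.κ)) := by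
    calc tr.θ (n + 1) / 2 * ‖r + (tr.post n).u‖ ^ 2 ≤ par.γ * tr.θ n / 2 * ε ^ 2 := by gcongr
      _ = par.γ / 2 * (tr.θ n * ε ^ 2) := by ring
      _ ≤ _ := by gcongr
  simp only [L₁]
  linarith

/-- Bounded outer duals give `θ ‖u‖ = O(1)`, hence the rate `1 / ε ^ 3`. -/
theorem exists_rate_of_dualsBounded (hC : P.IsSmoothnessConst C) (L W : ℝ) :
    ∃ K : ℝ, ∀ ε : ℝ, 0 < ε → ε ≤ 1 → ∀ tr : Trace N G E H,
      tr.IsRun P model par ε → tr.PenaltyCondition P model par ε C →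
      tr.StartsBoundedOrWarm P model par ε L → tr.DualsBounded P model par ε W →
      tr.ReachesWithin P model par ε (K / ε ^ 3) := by
  obtain ⟨L', hL'⟩ := exists_startsBounded_of_warm P model par L W
  obtain ⟨K, hK⟩ := exists_rate P model hC par one_ne_zero (W + par.dualBound) L'
  refine ⟨K, fun ε hε hε1 tr hrun hpen hst hW => hK ε hε hε1 tr hrun hpen
    (hL' ε hε hε1 tr hrun hst hW) fun n h hex => ?_⟩
  rw [pow_one]
  exact hrun.θ_mul_norm_slack_le hW h.of_succ hex

end complexity

end DLR

end

theorem mainTheorem5 {N G E : Type*} [Fintype N] [Fintype G] [Fintype E] {H : ℕ}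
    (P : DLR.Grid N G E H) (model : DLR.TempModel) :
    (∃ C : ℝ≥0, P.IsSmoothnessConst C) ∧
    ∀ C : ℝ≥0, P.IsSmoothnessConst C →
      ∀ (par : DLR.Params G E H) (L : ℝ),
        (∃ K : ℝ, ∀ ε : ℝ, 0 < ε → ε ≤ 1 → ∀ tr : DLR.Trace N G E H,
          tr.IsRun P model par ε → tr.PenaltyCondition P model par ε C →
          tr.StartsBounded P model par ε L →
          tr.ReachesWithin P model par ε (K / ε ^ 4)) ∧
        (∀ W : ℝ, ∃ K : ℝ, ∀ ε : ℝ, 0 < ε → ε ≤ 1 → ∀ tr : DLR.Trace N G E H,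
          tr.IsRun P model par ε → tr.PenaltyCondition P model par ε C →
          tr.StartsBoundedOrWarm P model par ε L →
          tr.DualsBounded P model par ε W →
          tr.ReachesWithin P model par ε (K / ε ^ 3)) := by
  exact ⟨P.exists_isSmoothnessConst, fun C hC par L =>
    ⟨DLR.exists_rate_of_startsBounded P model par hC L,
      fun W => DLR.exists_rate_of_dualsBounded hC L W⟩⟩
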